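/- Let $n\ge 1$ and let $A\in\mathbb{C}^{2^{n-1}\times 2^{n-1}}$ have full rank, with spectral norm $\|A\|_2$. For $\alpha>0$ call a unitary $U$ on $a+(n-1)$ qubits an $(\alpha,a)$-block-encoding of $A$ if $A=\alpha\,(\langle 0|^{\otimes a}\otimes I)\,U\,(|0\rangle^{\otimes a}\otimes I)$. Every $(\alpha,a)$-block-encoding of $A$ has $\alpha\ge\|A\|_2$, and this optimal normalization factor is attained with a single ancilla qubit by a circuit on $n$ qubits that consists of single-qubit gates and at most $$\tfrac{11}{48}\cdot 4^n-2^n+\tfrac73$$ C-NOT gates. More precisely, there are unitaries $W,V\in\mathbb{C}^{2^{n-1}\times 2^{n-1}}$, real angles $\theta_j$ with $\cos\theta_j>0$, and a diagonal unitary $\Delta$ such that $A/\|A\|_2=W\,\mathrm{diag}(\cos\theta_j)\,V^\dagger$ and such that, with the unitaries $A_1=W\,\mathrm{diag}(e^{i\theta_j})\,V^\dagger$ and $A_2=W\,\mathrm{diag}(e^{-i\theta_j})\,V^\dagger$, one has $A/\|A\|_2=\tfrac12(A_1+A_2)$ and the circuit implements the $(\|A\|_2,1)$-block-encoding $$U_A=(H\otimes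 I)(A_1\oplus A_2)(H\otimes I),$$ where $H$ is the Hadamard gate on the ancilla and $A_1\oplus A_2$ is the block-diagonal matrix selected by the ancilla. In the order of time, the circuit consists of $H$ on the ancilla, a circuit for $I\otimes\Delta V^\dagger$ (so $V^\dagger$ is synthesized only up to a diagonal), a circuit for the uniformly controlled rotation $\sum_j R_z(2\theta_j)\otimes|j\rangle\langle j|$ of the ancilla with $R_z(\varphi)=e^{i\varphi Z/2}$, a circuit for $I\otimes W\Delta^\dagger$, and $H$ on the ancilla; the C-NOT gates of the circuits for $I\otimes\Delta V^\dagger$ and $I\otimes W\Delta^\dagger$ act on the $n-1$ system qubits only. -/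

import Mathlib

open Matrix
open scoped Kronecker

noncomputable section

namespace SIABLE

/-- Labels of the computational basis of a register whose qubits are indexed by `Q`. -/
abbrev Bits (Q : Type) : Type := Q → Fin 2

/-- The spectral norm: the operator norm of `A` acting on the Euclidean space. -/
def specNorm {ι : Type} [Fintype ι] [DecidableEq ι] (A : Matrix ι ι ℂ) : ℝ :=
  ‖Matrix.toEuclideanCLM (n := ι) (𝕜 := ℂ) A‖

/-! ### Circuits over the library of all single-qubit gates and C-NOT -/

/-- A gate on the qubits `Q`: an arbitrary single-qubit unitary on one qubit, or a C-NOT with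
control `c` and target `t`. -/
inductive Gate (Q : Type) : Type where
  | single (q : Q) (u : Matrix.unitaryGroup (Fin 2) ℂ) : Gate Q
  | cnot (c t : Q) (h : c ≠ t) : Gate Q

/-- The matrix of a gate in the computational basis. -/
def Gate.toMatrix {Q : Type} [Fintype Q] [DecidableEq Q] :
    Gate Q → Matrix (Bits Q) (Bits Q) ℂ
  | .single q u => Matrix.of fun x y =>
      if ∀ r, r ≠ q → x r = y r then (u : Matrix (Fin 2) (Fin 2) ℂ) (x q) (y q) else 0
  | .cnot c t _ => Matrix.of fun x y =>
      if x = Function.update y t (y t + y c) then 1 else 0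

/-- Whether a gate is a C-NOT. -/
def Gate.isCnot {Q : Type} : Gate Q → Bool
  | .single _ _ => false
  | .cnot _ _ _ => true

/-- The gate does not let a qubit outside `S` interact: a C-NOT has both its qubits in `S`. -/
def Gate.InteractsWithin {Q : Type} (S : Set Q) : Gate Q → Prop
  | .single _ _ => True
  | .cnot c t _ => c ∈ S ∧ t ∈ S

/-- A circuit: the list of its gates in the order of time. -/
abbrev Circuit (Q : Type) : Type := List (Gate Q)

/-- The matrix of a circuit; the head of the list is applied first. -/
def Circuit.toMatrix {Q : Type} [Fintype Q] [DecidableEq Q] :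
    Circuit Q → Matrix (Bits Q) (Bits Q) ℂ
  | [] => 1
  | g :: C => Circuit.toMatrix C * g.toMatrix

/-- The number of C-NOT gates of a circuit. -/
def Circuit.cnotCount {Q : Type} (C : Circuit Q) : ℕ := List.countP Gate.isCnot C

/-! ### Block encodings -/

/-- `U`, acting on `a` ancilla qubits and `m` system qubits, is an `(α, a, ε)`-block-encoding
of `A`. The submatrix is `(⟨0|^{⊗ a} ⊗ I) U (|0⟩^{⊗ a} ⊗ I)`. -/
def IsBlockEncoding {m : ℕ} (α : ℝ) (a : ℕ) (ε : ℝ)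
    (A : Matrix (Bits (Fin m)) (Bits (Fin m)) ℂ)
    (U : Matrix (Bits (Fin a ⊕ Fin m)) (Bits (Fin a ⊕ Fin m)) ℂ) : Prop :=
  0 < α ∧ U ∈ Matrix.unitaryGroup (Bits (Fin a ⊕ Fin m)) ℂ ∧
    specNorm (A - (α : ℂ) •
      U.submatrix (fun i => Sum.elim (fun _ => 0) i) (fun j => Sum.elim (fun _ => 0) j)) ≤ ε

/-! ### One ancilla qubit on top of a system register -/

/-- The basis label of the ancilla and of the `m` system qubits. -/
def splitAncilla (m : ℕ) : Bits (Fin 1 ⊕ Fin m) ≃ Fin 2 × Bits (Fin m) :=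
  (Equiv.sumArrowEquivProdArrow (Fin 1) (Fin m) (Fin 2)).trans
    (Equiv.prodCongr (Equiv.funUnique (Fin 1) (Fin 2)) (Equiv.refl _))

/-- `M ⊗ N` with `M` on the ancilla and `N` on the system. -/
def tensor {m : ℕ} (M : Matrix (Fin 2) (Fin 2) ℂ) (N : Matrix (Bits (Fin m)) (Bits (Fin m)) ℂ) :
    Matrix (Bits (Fin 1 ⊕ Fin m)) (Bits (Fin 1 ⊕ Fin m)) ℂ :=
  (M ⊗ₖ N).submatrix (splitAncilla m) (splitAncilla m)

/-- The multiplexor `A₁ ⊕ A₂`, selected by the ancilla. -/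
def multiplexor {m : ℕ} (A₁ A₂ : Matrix (Bits (Fin m)) (Bits (Fin m)) ℂ) :
    Matrix (Bits (Fin 1 ⊕ Fin m)) (Bits (Fin 1 ⊕ Fin m)) ℂ :=
  (Matrix.of fun x y : Fin 2 × Bits (Fin m) =>
    if x.1 = y.1 then (if x.1 = 0 then A₁ else A₂) x.2 y.2 else 0).submatrix
      (splitAncilla m) (splitAncilla m)

/-- The rotation `R_z(φ) = exp(i φ Z / 2)`. -/
def Rz (φ : ℝ) : Matrix (Fin 2) (Fin 2) ℂ :=
  !![Complex.exp (Complex.I * (φ / 2)), 0; 0, Complex.exp (-(Complex.I * (φ / 2)))]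

/-- The uniformly controlled `z`-rotation of the ancilla: `R_z(φ j)` is applied to the ancilla
when the system is in the basis state `j`. -/
def ucrz {m : ℕ} (φ : Bits (Fin m) → ℝ) :
    Matrix (Bits (Fin 1 ⊕ Fin m)) (Bits (Fin 1 ⊕ Fin m)) ℂ :=
  (Matrix.of fun x y : Fin 2 × Bits (Fin m) =>
    if x.2 = y.2 then Rz (φ x.2) x.1 y.1 else 0).submatrix (splitAncilla m) (splitAncilla m)

/-- The Hadamard matrix. -/
def hMatrix : Matrix (Fin 2) (Fin 2) ℂ := ((1 / Real.sqrt 2 : ℝ) : ℂ) • !![1, 1; 1, -1]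

theorem hMatrix_mem_unitaryGroup : hMatrix ∈ Matrix.unitaryGroup (Fin 2) ℂ := by
  have h : ((Real.sqrt 2 : ℝ) : ℂ) * ((Real.sqrt 2 : ℝ) : ℂ) = 2 := by
    rw [← Complex.ofReal_mul, Real.mul_self_sqrt (by norm_num)]; norm_num
  have h' : ((Real.sqrt 2 : ℝ) : ℂ) ≠ 0 := by
    intro h0; rw [h0] at h; norm_num at h
  rw [Matrix.mem_unitaryGroup_iff]
  ext i j
  fin_cases i <;> fin_cases j <;>
    simp [hMatrix, Matrix.mul_apply, Fin.sum_univ_two, Matrix.star_apply] <;>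
    field_simp <;> rw [pow_two, h] <;> norm_num

/-- The Hadamard gate on the ancilla. -/
def hadamardGate (m : ℕ) : Gate (Fin 1 ⊕ Fin m) :=
  .single (Sum.inl 0) ⟨hMatrix, hMatrix_mem_unitaryGroup⟩

end SIABLE

end

/-!
Write `A = P diag(s) R` with unitary `P`, `R` and `s ≥ 0`. Full rank and `s j ≤ ‖A‖₂` give
`s j = ‖A‖₂ cos θ j` with `cos θ j > 0`, so that `A / ‖A‖₂` is the mean of the unitaries obtained by
replacing `cos θ j` by `exp (± i θ j)`. Conjugating the multiplexor of these two unitaries by the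
Hadamard gate puts their mean into the upper left block. The multiplexor itself is the uniformly
controlled rotation by `2 θ`, between the two unitaries of the singular value decomposition on the
system; a diagonal matrix of the system commutes with that rotation, so that the first of the two
unitaries is needed only up to a diagonal, which the second one absorbs. Conversely, the block of
a unitary is a contraction, whence the bound on the normalization factor.

It remains to count C-NOTs. A uniformly controlled rotation with `m` controls costs `2 ^ m` of them,
by halving: it is a product of two rotations with one control less, one of them conjugated by a
C-NOT (`exists_ucrz_eq_mul_headCnot`). For the unitaries of the system, let `d m` be a number of
C-NOTs that suffices up to a diagonal factor. The block-ZXZ decomposition (`exists_block_zxz`)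
writes a unitary on `m + 1` qubits as a product of three multiplexors, separated by Hadamard gates
on one qubit. Each multiplexor is a uniformly controlled rotation between two unitaries on `m`
qubits (`exists_demultiplexing`). The C-NOTs at the inner ends of the two outer rotations are
controlled sign flips between the Hadamard gates and disappear in the central multiplexor before
that one is split (`exists_absorb_ancillaCnot`), and the two unitaries that meet on either side of
the center join it as well. Four unitaries on `m` qubits are left, and three of them are needed only
up to a diagonal, since the diagonal commutes with everything up to the next unitary on its left.
Hence `d (m + 1) = 4 d m + 3 * 2 ^ m - 2`, and the exact synthesis costs `d m + 1` throughout if it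
does so for `m = 2` (`synthesis_succ`).

The base `d 2 = 2`, with `3` for the exact synthesis, is the theory of two-qubit gates in the magic
basis. In that basis the local unitaries of determinant one are the rotations of `ℝ⁴`; this follows
from the generation of the orthogonal group by reflections, a reflection being a local unitary times
the exchange of the qubits (`IsRealOrthogonal.ofMagic`). A unitary `U` is `O₁ D O₂` with real
orthogonal `O₁`, `O₂` and diagonal `D` (`exists_realOrthogonal_mul_diagonal_mul`), and if `U` has
determinant one and the trace of `Uᵀ σ U σ` is real, where `σ = - Y ⊗ Y`, then the entries of `D`
can be arranged in inverse pairs, which makes `D` a product of two C-NOTs and local gates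
(`exists_local_mul_ofMagic_diagonal_mul_local`, `exists_ofMagic_diagonal_eq_cnot`). One real
parameter is enough to reach the trace condition; it is provided by a diagonal
`exp (i t Z ⊗ Z)` or by a further C-NOT with a rotation of its target (`exists_isTwoCnot_mul`).

With `d m = 11/24 * 4 ^ m - 3/2 * 2 ^ m + 2/3` for `m ≥ 2` the total `2 d m + 1 + 2 ^ m` is exactly
the bound with `n = m + 1`.
-/

namespace SIABLE

/-! ### Diagonalization and singular values -/

section LinearAlgebra

variable {𝕜 n : Type*} [RCLike 𝕜] [Fintype n]

lemma exists_orthonormalBasis_joint_eigenvectors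
    {A B : EuclideanSpace 𝕜 n →ₗ[𝕜] EuclideanSpace 𝕜 n} (hA : A.IsSymmetric)
    (hB : B.IsSymmetric) (hAB : Commute A B) :
    ∃ (b : OrthonormalBasis n 𝕜 (EuclideanSpace 𝕜 n)) (α β : n → 𝕜),
      ∀ j, A (b j) = α j • b j ∧ B (b j) = β j • b j := by
  classical
  let f : Module.End.Eigenvalues A × Module.End.Eigenvalues B → 𝕜 × 𝕜 := fun i => (i.2, i.1)
  have hf : Function.Injective f := by
    rintro ⟨a, b⟩ ⟨c, d⟩ h
    have h1 := congrArg Prod.fst h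
    have h2 := congrArg Prod.snd h
    exact Prod.ext (Subtype.ext h2) (Subtype.ext h1)
  have hfam := (LinearMap.IsSymmetric.orthogonalFamily_eigenspace_inf_eigenspace hA hB).comp hf
  have hint : DirectSum.IsInternal
      (fun i => Module.End.eigenspace A (f i).2 ⊓ Module.End.eigenspace B (f i).1) := by
    rw [OrthogonalFamily.isInternal_iff hfam, Submodule.orthogonal_eq_bot_iff, eq_top_iff,
      ← LinearMap.IsSymmetric.iSup_iSup_eigenspace_inf_eigenspace_eq_top_of_commute hA hB hAB]
    refine iSup_le fun a => iSup_le fun c => ?_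
    by_cases ha : Module.End.HasEigenvalue A a
    · by_cases hc : Module.End.HasEigenvalue B c
      · exact le_iSup (fun i => Module.End.eigenspace A (f i).2 ⊓ Module.End.eigenspace B (f i).1)
          (⟨a, ha⟩, ⟨c, hc⟩)
      · have : Module.End.eigenspace B c = ⊥ := by
          simpa [Module.End.hasEigenvalue_iff] using hc
        simp [this]
    · have : Module.End.eigenspace A a = ⊥ := by
        simpa [Module.End.hasEigenvalue_iff] using ha
      simp [this]
  have hn : Module.finrank 𝕜 (EuclideanSpace 𝕜 n) = Fintype.card n := finrank_euclideanSpace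
  let e : Fin (Fintype.card n) ≃ n := (Fintype.equivFin n).symm
  refine ⟨(hint.subordinateOrthonormalBasis hn hfam).reindex e,
    fun j => (f (hint.subordinateOrthonormalBasisIndex hn (e.symm j) hfam)).2,
    fun j => (f (hint.subordinateOrthonormalBasisIndex hn (e.symm j) hfam)).1, fun j => ?_⟩
  have h := hint.subordinateOrthonormalBasis_subordinate hn (e.symm j) hfam
  rw [OrthonormalBasis.reindex_apply]
  exact ⟨Module.End.mem_eigenspace_iff.mp h.1, Module.End.mem_eigenspace_iff.mp h.2⟩

variable [DecidableEq n]

/-- The unitary matrix whose columns are the vectors of an orthonormal basis. -/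
lemma exists_unitary_of_orthonormalBasis (b : OrthonormalBasis n 𝕜 (EuclideanSpace 𝕜 n)) :
    ∃ P ∈ Matrix.unitaryGroup n 𝕜, ∀ i j, P i j = b j i :=
  ⟨(EuclideanSpace.basisFun n 𝕜).toBasis.toMatrix b.toBasis,
    (EuclideanSpace.basisFun n 𝕜).toMatrix_orthonormalBasis_mem_unitary b, fun _ _ => rfl⟩

/-- Commuting Hermitian matrices are diagonal in a common orthonormal basis; over `ℝ` this is
the orthogonal diagonalization of commuting symmetric matrices. -/
lemma exists_unitary_joint_diagonalization {A B : Matrix n n 𝕜} (hA : A.IsHermitian)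
    (hB : B.IsHermitian) (hAB : A * B = B * A) :
    ∃ P ∈ Matrix.unitaryGroup n 𝕜, ∃ α β : n → 𝕜,
      A = P * diagonal α * Pᴴ ∧ B = P * diagonal β * Pᴴ := by
  have hcomm : Commute (toEuclideanLin A) (toEuclideanLin B) := by
    refine LinearMap.ext fun x => ?_
    simp only [Module.End.mul_apply, toLpLin_apply, mulVec_mulVec, hAB]
  obtain ⟨b, α, β, h⟩ := exists_orthonormalBasis_joint_eigenvectors
    (isSymmetric_toEuclideanLin_iff.mpr hA) (isSymmetric_toEuclideanLin_iff.mpr hB) hcomm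
  obtain ⟨P, hP, hPb⟩ := exists_unitary_of_orthonormalBasis b
  have key : ∀ (C : Matrix n n 𝕜) (γ : n → 𝕜), (∀ j, toEuclideanLin C (b j) = γ j • b j) →
      C = P * diagonal γ * Pᴴ := by
    intro C γ hC
    have hCP : C * P = P * diagonal γ := by
      ext i j
      have := congrArg (fun v => v.ofLp i) (hC j)
      simp only [toLpLin_apply, PiLp.smul_apply, smul_eq_mul, mulVec, dotProduct] at this
      rw [mul_diagonal, hPb, mul_comm, ← this, mul_apply]
      exact Finset.sum_congr rfl fun k _ => by rw [hPb]
    rw [← hCP, mul_assoc, ← star_eq_conjTranspose, mem_unitaryGroup_iff.mp hP, mul_one]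
  exact ⟨P, hP, α, β, key A α fun j => (h j).1, key B β fun j => (h j).2⟩

lemma norm_eq_one_of_diagonal_mem_unitaryGroup {d : n → 𝕜}
    (h : diagonal d ∈ Matrix.unitaryGroup n 𝕜) (j : n) : ‖d j‖ = 1 := by
  have := congrFun (congrFun (mem_unitaryGroup_iff.mp h) j) j
  rw [star_eq_conjTranspose, diagonal_conjTranspose, diagonal_mul_diagonal, diagonal_apply_eq,
    one_apply_eq, Pi.star_apply, RCLike.star_def, RCLike.mul_conj] at this
  have h2 : ‖d j‖ ^ 2 = 1 := by exact_mod_cast this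
  nlinarith [norm_nonneg (d j)]

lemma diagonal_mem_unitaryGroup {d : n → 𝕜} (h : ∀ j, ‖d j‖ = 1) :
    diagonal d ∈ Matrix.unitaryGroup n 𝕜 := by
  rw [mem_unitaryGroup_iff, star_eq_conjTranspose, diagonal_conjTranspose, diagonal_mul_diagonal,
    ← diagonal_one]
  congr 1
  ext j
  simp [RCLike.mul_conj, h j]

/-- A unitary matrix is unitarily diagonalizable: its Hermitian and skew-Hermitian parts
commute. -/
lemma exists_unitary_diagonalization {U : Matrix n n ℂ} (hU : U ∈ Matrix.unitaryGroup n ℂ) :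
    ∃ P ∈ Matrix.unitaryGroup n ℂ, ∃ d : n → ℂ, (∀ j, ‖d j‖ = 1) ∧
      U = P * diagonal d * Pᴴ := by
  have h1 := mem_unitaryGroup_iff.mp hU
  have h2 := mem_unitaryGroup_iff'.mp hU
  rw [star_eq_conjTranspose] at h1 h2
  obtain ⟨P, hP, α, β, hα, hβ⟩ := exists_unitary_joint_diagonalization
    (A := U + Uᴴ) (B := Complex.I • (U - Uᴴ))
    (by simp [IsHermitian, add_comm])
    (by simp [IsHermitian, conjTranspose_smul, smul_sub]; abel)
    (by simp only [mul_smul_comm, smul_mul_assoc, mul_sub, sub_mul, mul_add, add_mul, h1, h2,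
      ← smul_add]; congr 1; abel)
  have hUd : U = P * diagonal (fun j => (1 / 2 : ℂ) * (α j - Complex.I * β j)) * Pᴴ := by
    have : U = (1 / 2 : ℂ) • ((U + Uᴴ) - Complex.I • (Complex.I • (U - Uᴴ))) := by
      rw [smul_smul, Complex.I_mul_I]
      ext i j
      simp only [Matrix.smul_apply, Matrix.sub_apply, Matrix.add_apply, smul_eq_mul]
      ring
    have hd : diagonal (fun j => (1 / 2 : ℂ) * (α j - Complex.I * β j)) =
        (1 / 2 : ℂ) • (diagonal α - Complex.I • diagonal β) := by
      ext i j
      by_cases hij : i = j <;> simp [diagonal, hij]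
    rw [hd, this, hα, hβ]
    simp only [mul_smul_comm, smul_mul_assoc, mul_sub, sub_mul]
  refine ⟨P, hP, _, fun j => ?_, hUd⟩
  refine norm_eq_one_of_diagonal_mem_unitaryGroup (𝕜 := ℂ)
    (d := fun j => (1 / 2 : ℂ) * (α j - Complex.I * β j)) ?_ j
  have hP1 := mem_unitaryGroup_iff'.mp hP
  rw [star_eq_conjTranspose] at hP1
  have : diagonal (fun j => (1 / 2 : ℂ) * (α j - Complex.I * β j)) = Pᴴ * U * P := by
    rw [hUd]
    simp only [mul_assoc, hP1, mul_one]
    rw [← mul_assoc, hP1, one_mul]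
  rw [this]
  exact mul_mem (mul_mem (Unitary.star_mem hP) hU) hP

/-- A matrix with orthogonal rows of lengths `s i` is `diag s` times a unitary matrix; rows with
`s i = 0` leave freedom in the unitary factor. -/
lemma exists_eq_diagonal_mul_unitary {M : Matrix n n ℂ} {s : n → ℝ}
    (h : M * Mᴴ = diagonal (fun i => ((s i : ℂ)) ^ 2)) :
    ∃ R ∈ Matrix.unitaryGroup n ℂ, M = diagonal (fun i => (s i : ℂ)) * R := by
  let v : n → EuclideanSpace ℂ n := fun i => WithLp.toLp 2 fun k => (s i : ℂ)⁻¹ * M i k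
  have hrow : ∀ i j, ∑ k, M i k * star (M j k) = if i = j then (s i : ℂ) ^ 2 else 0 := by
    intro i j
    have := congrFun (congrFun h i) j
    simpa [mul_apply, diagonal_apply] using this
  have hv : Orthonormal ℂ (Set.domRestrict {i | s i ≠ 0} v) := by
    rw [orthonormal_iff_ite]
    rintro ⟨i, hi⟩ ⟨j, hj⟩
    have hi' : (s i : ℂ) ≠ 0 := by exact_mod_cast hi
    have : inner ℂ (v i) (v j) = (s i : ℂ)⁻¹ * (s j : ℂ)⁻¹ * ∑ k, M j k * star (M i k) := by
      rw [PiLp.inner_apply, Finset.mul_sum]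
      refine Finset.sum_congr rfl fun k _ => ?_
      simp [v]
      ring
    simp only [Set.domRestrict_apply, this, hrow, Subtype.mk.injEq]
    by_cases hij : i = j
    · subst hij; simp; field_simp
    · simp [hij, Ne.symm hij]
  obtain ⟨b, hb⟩ := hv.exists_orthonormalBasis_extension_of_card_eq finrank_euclideanSpace
  obtain ⟨P, hP, hPb⟩ := exists_unitary_of_orthonormalBasis b
  refine ⟨Pᵀ, transpose_mem_unitaryGroup_iff.mpr hP, ?_⟩
  ext i k
  rw [diagonal_mul, transpose_apply, hPb]
  by_cases hi : s i = 0
  · have h0 := hrow i i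
    have h1 : ∑ k, ‖M i k‖ ^ 2 = 0 := by
      have : ((∑ k, ‖M i k‖ ^ 2 : ℝ) : ℂ) = 0 := by
        simpa [hi, Complex.mul_conj'] using h0
      exact_mod_cast this
    have h2 := (Finset.sum_eq_zero_iff_of_nonneg fun k _ => sq_nonneg ‖M i k‖).mp h1 k
      (Finset.mem_univ k)
    have h3 : M i k = 0 := by simpa using h2
    simp [hi, h3]
  · rw [hb i hi]
    have hi' : (s i : ℂ) ≠ 0 := by exact_mod_cast hi
    simp [v, hi']

open scoped ComplexOrder in
/-- Singular value decomposition of a square matrix. -/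
lemma exists_singular_value_decomposition (A : Matrix n n ℂ) :
    ∃ P ∈ Matrix.unitaryGroup n ℂ, ∃ R ∈ Matrix.unitaryGroup n ℂ, ∃ s : n → ℝ, (∀ i, 0 ≤ s i) ∧
      A = P * diagonal (fun i => (s i : ℂ)) * R := by
  have hA : (A * Aᴴ).PosSemidef := posSemidef_self_mul_conjTranspose A
  obtain ⟨P, hP, e, he, hspec⟩ : ∃ P ∈ Matrix.unitaryGroup n ℂ, ∃ e : n → ℝ, (∀ i, 0 ≤ e i) ∧
      A * Aᴴ = P * diagonal (fun i => (e i : ℂ)) * Pᴴ := by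
    refine ⟨_, hA.1.eigenvectorUnitary.2, hA.1.eigenvalues, hA.eigenvalues_nonneg, ?_⟩
    conv_lhs => rw [hA.1.spectral_theorem, Unitary.conjStarAlgAut_apply]
    rfl
  have hP1 := mem_unitaryGroup_iff.mp hP
  have hP2 := mem_unitaryGroup_iff'.mp hP
  rw [star_eq_conjTranspose] at hP1 hP2
  obtain ⟨R, hR, hRA⟩ := exists_eq_diagonal_mul_unitary (M := Pᴴ * A)
    (s := fun i => Real.sqrt (e i)) (by
      rw [conjTranspose_mul, conjTranspose_conjTranspose,
        show Pᴴ * A * (Aᴴ * P) = Pᴴ * (A * Aᴴ) * P by simp only [mul_assoc], hspec,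
        show Pᴴ * (P * diagonal (fun i => (e i : ℂ)) * Pᴴ) * P =
          (Pᴴ * P) * diagonal (fun i => (e i : ℂ)) * (Pᴴ * P) by
          simp only [mul_assoc], hP2, one_mul, mul_one]
      congr 1
      ext i
      rw [← Complex.ofReal_pow, Real.sq_sqrt (he i)])
  refine ⟨P, hP, R, hR, fun i => Real.sqrt (e i), fun i => Real.sqrt_nonneg _, ?_⟩
  rw [mul_assoc, ← hRA, ← mul_assoc, hP1, one_mul]

end LinearAlgebra

/-! ### Composing and relabelling circuits -/

section Circuits

variable {Q Q' : Type}

/-- The same gate on a register that contains the qubits `Q` as the image of `f`. -/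
def Gate.map (f : Q ↪ Q') : Gate Q → Gate Q'
  | .single q u => .single (f q) u
  | .cnot c t h => .cnot (f c) (f t) (f.injective.ne h)

lemma Gate.isCnot_map (f : Q ↪ Q') (g : Gate Q) : (g.map f).isCnot = g.isCnot := by
  cases g <;> rfl

lemma Gate.map_interactsWithin (f : Q ↪ Q') (g : Gate Q) :
    (g.map f).InteractsWithin (Set.range f) := by
  cases g
  · trivial
  · exact ⟨⟨_, rfl⟩, ⟨_, rfl⟩⟩

/-- The same circuit on a register that contains the qubits `Q` as the image of `f`. -/
def Circuit.map (f : Q ↪ Q') (C : Circuit Q) : Circuit Q' := List.map (Gate.map f) C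

lemma Circuit.cnotCount_map (f : Q ↪ Q') (C : Circuit Q) :
    (C.map f).cnotCount = C.cnotCount := by
  induction C with
  | nil => rfl
  | cons g C ih =>
    simp only [Circuit.cnotCount, Circuit.map, List.map_cons, List.countP_cons,
      Gate.isCnot_map] at ih ⊢
    rw [ih]

lemma Circuit.cnotCount_append (C D : Circuit Q) :
    Circuit.cnotCount (C ++ D) = C.cnotCount + D.cnotCount :=
  List.countP_append

variable [Fintype Q] [DecidableEq Q] [Fintype Q'] [DecidableEq Q']

lemma Circuit.toMatrix_append (C D : Circuit Q) :
    Circuit.toMatrix (C ++ D) = D.toMatrix * C.toMatrix := by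
  induction C with
  | nil => simp [Circuit.toMatrix]
  | cons g C ih => simp [Circuit.toMatrix, ih, mul_assoc]

/-- `U` is the matrix of a circuit with at most `k` C-NOT gates. -/
def Synthesizable (k : ℕ) (U : Matrix (Bits Q) (Bits Q) ℂ) : Prop :=
  ∃ C : Circuit Q, C.toMatrix = U ∧ C.cnotCount ≤ k

lemma Synthesizable.mul {k l : ℕ} {U V : Matrix (Bits Q) (Bits Q) ℂ}
    (hU : Synthesizable k U) (hV : Synthesizable l V) : Synthesizable (k + l) (U * V) := by
  obtain ⟨C, hC, hk⟩ := hU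
  obtain ⟨D, hD, hl⟩ := hV
  refine ⟨D ++ C, by rw [Circuit.toMatrix_append, hC, hD], ?_⟩
  rw [Circuit.cnotCount_append]
  omega

lemma Synthesizable.mono {k l : ℕ} {U : Matrix (Bits Q) (Bits Q) ℂ}
    (hU : Synthesizable k U) (h : k ≤ l) : Synthesizable l U := by
  obtain ⟨C, hC, hk⟩ := hU
  exact ⟨C, hC, hk.trans h⟩

lemma synthesizable_single (q : Q) {u : Matrix (Fin 2) (Fin 2) ℂ}
    (hu : u ∈ Matrix.unitaryGroup (Fin 2) ℂ) :
    Synthesizable 0 (Gate.single q ⟨u, hu⟩).toMatrix :=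
  ⟨[.single q ⟨u, hu⟩], by simp [Circuit.toMatrix], by simp [Circuit.cnotCount, Gate.isCnot]⟩

lemma synthesizable_cnot {c t : Q} (h : c ≠ t) :
    Synthesizable 1 (Gate.cnot c t h).toMatrix :=
  ⟨[.cnot c t h], by simp [Circuit.toMatrix], by simp [Circuit.cnotCount, Gate.isCnot]⟩

lemma Gate.toMatrix_map_equiv (e : Q ≃ Q') (g : Gate Q) :
    (g.map e.toEmbedding).toMatrix =
      g.toMatrix.submatrix (e.arrowCongr (Equiv.refl (Fin 2))).symm
        (e.arrowCongr (Equiv.refl (Fin 2))).symm := by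
  ext x y
  cases g with
  | single q u =>
    simp only [Gate.map, Gate.toMatrix, of_apply, submatrix_apply]
    refine if_congr ?_ (by simp [Equiv.arrowCongr]) rfl
    constructor
    · intro h r hr
      exact h (e r) (e.injective.ne hr)
    · intro h r hr
      have := h (e.symm r) (fun h' => hr (by simp [← h']))
      simpa [Equiv.arrowCongr] using this
  | cnot c t h =>
    simp only [Gate.map, Gate.toMatrix, of_apply, submatrix_apply]
    refine if_congr ?_ rfl rfl
    simp only [funext_iff, Function.update_apply]
    constructor
    · intro h r
      have := h (e r)
      simpa [Equiv.arrowCongr] using this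
    · intro h r
      have := h (e.symm r)
      simpa [Equiv.arrowCongr, Equiv.symm_apply_eq] using this

lemma Circuit.toMatrix_map_equiv (e : Q ≃ Q') (C : Circuit Q) :
    (C.map e.toEmbedding).toMatrix =
      C.toMatrix.submatrix (e.arrowCongr (Equiv.refl (Fin 2))).symm
        (e.arrowCongr (Equiv.refl (Fin 2))).symm := by
  induction C with
  | nil => simp [Circuit.map, Circuit.toMatrix]
  | cons g C ih =>
    have : Circuit.map e.toEmbedding (g :: C) =
      g.map e.toEmbedding :: Circuit.map e.toEmbedding C := rfl
    rw [this, Circuit.toMatrix, Circuit.toMatrix, ih, Gate.toMatrix_map_equiv, submatrix_mul_equiv]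

lemma Synthesizable.of_equiv (e : Q ≃ Q') {k : ℕ} {U : Matrix (Bits Q') (Bits Q') ℂ}
    (h : Synthesizable k (U.submatrix (e.arrowCongr (Equiv.refl (Fin 2)))
      (e.arrowCongr (Equiv.refl (Fin 2))))) : Synthesizable k U := by
  obtain ⟨C, hC, hk⟩ := h
  refine ⟨C.map e.toEmbedding, ?_, by rwa [Circuit.cnotCount_map]⟩
  rw [Circuit.toMatrix_map_equiv, hC, submatrix_submatrix, Equiv.self_comp_symm, submatrix_id_id]

end Circuits

/-! ### Block matrices over the ancilla -/

section Blocks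

variable {m : ℕ}

lemma tensor_apply (M : Matrix (Fin 2) (Fin 2) ℂ) (N : Matrix (Bits (Fin m)) (Bits (Fin m)) ℂ)
    (x y : Bits (Fin 1 ⊕ Fin m)) : tensor M N x y =
      M (x (Sum.inl 0)) (y (Sum.inl 0)) * N (fun i => x (Sum.inr i)) (fun i => y (Sum.inr i)) :=
  rfl

lemma tensor_mul (M M' : Matrix (Fin 2) (Fin 2) ℂ)
    (N N' : Matrix (Bits (Fin m)) (Bits (Fin m)) ℂ) :
    tensor M N * tensor M' N' = tensor (M * M') (N * N') := by
  simp only [tensor]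
  rw [submatrix_mul_equiv, mul_kronecker_mul]

lemma tensor_one : tensor (1 : Matrix (Fin 2) (Fin 2) ℂ)
    (1 : Matrix (Bits (Fin m)) (Bits (Fin m)) ℂ) = 1 := by
  simp [tensor]

lemma tensor_mem_unitaryGroup {M : Matrix (Fin 2) (Fin 2) ℂ}
    {N : Matrix (Bits (Fin m)) (Bits (Fin m)) ℂ} (hM : M ∈ Matrix.unitaryGroup (Fin 2) ℂ)
    (hN : N ∈ Matrix.unitaryGroup (Bits (Fin m)) ℂ) :
    tensor M N ∈ Matrix.unitaryGroup (Bits (Fin 1 ⊕ Fin m)) ℂ := by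
  rw [mem_unitaryGroup_iff, star_eq_conjTranspose] at *
  have : (tensor M N)ᴴ = tensor Mᴴ Nᴴ := by
    rw [tensor, conjTranspose_submatrix, conjTranspose_kronecker, tensor]
  rw [this, tensor_mul, hM, hN, tensor_one]

/-- The basis label of the ancilla and the system as an element of one of two copies of the labels
of the system, the left copy being that of the ancilla value `0`. -/
def ancillaSum (m : ℕ) : Bits (Fin 1 ⊕ Fin m) ≃ Bits (Fin m) ⊕ Bits (Fin m) :=
  (splitAncilla m).trans
    ((Equiv.prodCongr finTwoEquiv (Equiv.refl _)).trans (Equiv.boolProdEquivSum _))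

/-- The `2 × 2` block matrix whose blocks are selected by the ancilla. -/
def blocks (X Y Z T : Matrix (Bits (Fin m)) (Bits (Fin m)) ℂ) :
    Matrix (Bits (Fin 1 ⊕ Fin m)) (Bits (Fin 1 ⊕ Fin m)) ℂ :=
  (fromBlocks X Y Z T).submatrix (ancillaSum m) (ancillaSum m)

lemma blocks_mul (X Y Z T X' Y' Z' T' : Matrix (Bits (Fin m)) (Bits (Fin m)) ℂ) :
    blocks X Y Z T * blocks X' Y' Z' T' =
      blocks (X * X' + Y * Z') (X * Y' + Y * T') (Z * X' + T * Z') (Z * Y' + T * T') := by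
  simp only [blocks]
  rw [submatrix_mul_equiv, fromBlocks_multiply]

lemma blocks_one : blocks (1 : Matrix (Bits (Fin m)) (Bits (Fin m)) ℂ) 0 0 1 = 1 := by
  simp [blocks]

lemma blocks_conjTranspose (X Y Z T : Matrix (Bits (Fin m)) (Bits (Fin m)) ℂ) :
    (blocks X Y Z T)ᴴ = blocks Xᴴ Zᴴ Yᴴ Tᴴ := by
  simp only [blocks]
  rw [conjTranspose_submatrix, fromBlocks_conjTranspose]

lemma exists_eq_blocks (U : Matrix (Bits (Fin 1 ⊕ Fin m)) (Bits (Fin 1 ⊕ Fin m)) ℂ) :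
    ∃ X Y Z T, U = blocks X Y Z T := by
  let V := U.submatrix (ancillaSum m).symm (ancillaSum m).symm
  refine ⟨V.toBlocks₁₁, V.toBlocks₁₂, V.toBlocks₂₁, V.toBlocks₂₂, ?_⟩
  rw [blocks, fromBlocks_toBlocks]
  simp [V]

lemma blocks_inj {X Y Z T X' Y' Z' T' : Matrix (Bits (Fin m)) (Bits (Fin m)) ℂ} :
    blocks X Y Z T = blocks X' Y' Z' T' ↔ X = X' ∧ Y = Y' ∧ Z = Z' ∧ T = T' := by
  rw [← fromBlocks_inj]
  constructor
  · intro h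
    have := congrArg (fun A => A.submatrix (ancillaSum m).symm (ancillaSum m).symm) h
    simpa [blocks] using this
  · intro h
    rw [blocks, h, blocks]

/-- Entrywise description of `blocks`. -/
lemma eq_blocks_iff {X Y Z T : Matrix (Bits (Fin m)) (Bits (Fin m)) ℂ}
    {U : Matrix (Bits (Fin 1 ⊕ Fin m)) (Bits (Fin 1 ⊕ Fin m)) ℂ} :
    U = blocks X Y Z T ↔ ∀ i j,
      U ((splitAncilla m).symm (0, i)) ((splitAncilla m).symm (0, j)) = X i j ∧
      U ((splitAncilla m).symm (0, i)) ((splitAncilla m).symm (1, j)) = Y i j ∧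
      U ((splitAncilla m).symm (1, i)) ((splitAncilla m).symm (0, j)) = Z i j ∧
      U ((splitAncilla m).symm (1, i)) ((splitAncilla m).symm (1, j)) = T i j := by
  obtain ⟨X', Y', Z', T', rfl⟩ := exists_eq_blocks U
  rw [blocks_inj]
  simp only [blocks, ← Matrix.ext_iff, submatrix_apply, ancillaSum, Equiv.trans_apply,
    Equiv.apply_symm_apply, Equiv.prodCongr_apply, Prod.map, Equiv.refl_apply]
  have h0 : ∀ i : Bits (Fin m), Equiv.boolProdEquivSum _ (finTwoEquiv 0, i) = Sum.inl i :=
    fun i => rfl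
  have h1 : ∀ i : Bits (Fin m), Equiv.boolProdEquivSum _ (finTwoEquiv 1, i) = Sum.inr i :=
    fun i => rfl
  simp only [h0, h1, fromBlocks_apply₁₁, fromBlocks_apply₁₂, fromBlocks_apply₂₁,
    fromBlocks_apply₂₂]
  exact ⟨fun ⟨a, b, c, d⟩ i j => ⟨a i j, b i j, c i j, d i j⟩,
    fun h => ⟨fun i j => (h i j).1, fun i j => (h i j).2.1, fun i j => (h i j).2.2.1,
      fun i j => (h i j).2.2.2⟩⟩

lemma tensor_eq_blocks (M : Matrix (Fin 2) (Fin 2) ℂ)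
    (N : Matrix (Bits (Fin m)) (Bits (Fin m)) ℂ) :
    tensor M N = blocks (M 0 0 • N) (M 0 1 • N) (M 1 0 • N) (M 1 1 • N) :=
  eq_blocks_iff.mpr fun _ _ => ⟨rfl, rfl, rfl, rfl⟩

lemma multiplexor_eq_blocks (A B : Matrix (Bits (Fin m)) (Bits (Fin m)) ℂ) :
    multiplexor A B = blocks A 0 0 B := by
  refine eq_blocks_iff.mpr fun _ _ => ?_
  simp [multiplexor]

lemma ucrz_eq_blocks (φ : Bits (Fin m) → ℝ) :
    ucrz φ = blocks (diagonal fun j => Complex.exp (Complex.I * (φ j / 2))) 0 0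
      (diagonal fun j => Complex.exp (-(Complex.I * (φ j / 2)))) := by
  refine eq_blocks_iff.mpr fun i j => ?_
  by_cases h : i = j <;> simp [ucrz, Rz, diagonal, h]

/-- The C-NOT whose control is the system qubit `q` and whose target is the ancilla. -/
def ancillaCnot (q : Fin m) : Gate (Fin 1 ⊕ Fin m) :=
  .cnot (Sum.inr q) (Sum.inl 0) Sum.inr_ne_inl

lemma ancillaCnot_toMatrix (q : Fin m) : (ancillaCnot q).toMatrix =
    blocks (diagonal fun j => if j q = 0 then 1 else 0) (diagonal fun j => if j q = 1 then 1 else 0)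
      (diagonal fun j => if j q = 1 then 1 else 0) (diagonal fun j => if j q = 0 then 1 else 0) := by
  refine eq_blocks_iff.mpr fun i j => ?_
  have key : ∀ a b : Fin 2, (splitAncilla m).symm (a, i) =
      Function.update ((splitAncilla m).symm (b, j)) (Sum.inl 0) (b + j q) ↔
      a = b + j q ∧ i = j := by
    intro a b
    have : Function.update ((splitAncilla m).symm (b, j)) (Sum.inl 0) (b + j q) =
        (splitAncilla m).symm (b + j q, j) := by
      ext r
      rcases r with r | r
      · obtain rfl := Subsingleton.elim r 0
        rw [Function.update_self]
        rfl
      · rw [Function.update_of_ne Sum.inr_ne_inl]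
        rfl
    rw [this, Equiv.apply_eq_iff_eq, Prod.mk.injEq]
  have hval : ∀ b : Fin 2, (splitAncilla m).symm (b, j) (Sum.inl 0) = b := fun b => rfl
  have hval' : ∀ b : Fin 2, (splitAncilla m).symm (b, j) (Sum.inr q) = j q := fun b => rfl
  simp only [ancillaCnot, Gate.toMatrix, of_apply, hval, hval', key]
  by_cases h : i = j
  · subst h
    rcases Fin.exists_fin_two.mp ⟨i q, rfl⟩ with h | h <;> simp [h]
  · simp [h]

lemma ancillaSingle_toMatrix (u : Matrix.unitaryGroup (Fin 2) ℂ) :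
    (Gate.single (Sum.inl 0 : Fin 1 ⊕ Fin m) u).toMatrix = tensor u 1 := by
  ext x y
  rw [tensor_apply, Gate.toMatrix, of_apply, one_apply]
  have : (∀ r, r ≠ Sum.inl 0 → x r = y r) ↔
      (fun i => x (Sum.inr i)) = fun i => y (Sum.inr i) := by
    rw [funext_iff]
    constructor
    · intro h i
      exact h _ Sum.inr_ne_inl
    · rintro h (r | r) hr
      · exact absurd (congrArg Sum.inl (Subsingleton.elim r 0)) hr
      · exact h r
  rw [if_congr this rfl rfl, mul_ite, mul_one, mul_zero]

lemma synthesizable_tensor_one {u : Matrix (Fin 2) (Fin 2) ℂ}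
    (hu : u ∈ Matrix.unitaryGroup (Fin 2) ℂ) :
    Synthesizable 0 (tensor u (1 : Matrix (Bits (Fin m)) (Bits (Fin m)) ℂ)) := by
  have := synthesizable_single (Sum.inl 0 : Fin 1 ⊕ Fin m) hu
  rwa [ancillaSingle_toMatrix] at this

lemma Gate.toMatrix_map_inr (g : Gate (Fin m)) :
    (g.map (Function.Embedding.inr : Fin m ↪ Fin 1 ⊕ Fin m)).toMatrix = tensor 1 g.toMatrix := by
  ext x y
  rw [tensor_apply, one_apply]
  cases g with
  | single q u =>
    simp only [Gate.map, Gate.toMatrix, of_apply, Function.Embedding.inr_apply, ite_mul, one_mul,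
      zero_mul, ← ite_and]
    refine if_congr ?_ rfl rfl
    constructor
    · intro h
      exact ⟨h _ Sum.inl_ne_inr, fun r hr => h _ (Sum.inr_injective.ne hr)⟩
    · rintro ⟨h, h'⟩ (r | r) hr
      · rwa [Subsingleton.elim r 0]
      · exact h' r fun h'' => hr (by rw [h''])
  | cnot c t h =>
    simp only [Gate.map, Gate.toMatrix, of_apply, Function.Embedding.inr_apply, ite_mul, one_mul,
      zero_mul, ← ite_and]
    refine if_congr ?_ rfl rfl
    simp only [funext_iff, Sum.forall, Function.update_apply, Sum.inr.injEq, reduceCtorEq, if_false]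
    refine and_congr ?_ Iff.rfl
    exact ⟨fun h => h 0, fun h r => by rwa [Subsingleton.elim r 0]⟩

lemma Circuit.toMatrix_map_inr (C : Circuit (Fin m)) :
    (C.map (Function.Embedding.inr : Fin m ↪ Fin 1 ⊕ Fin m)).toMatrix = tensor 1 C.toMatrix := by
  induction C with
  | nil => exact tensor_one.symm
  | cons g C ih =>
    have : Circuit.map (Function.Embedding.inr : Fin m ↪ Fin 1 ⊕ Fin m) (g :: C) =
      g.map Function.Embedding.inr :: Circuit.map Function.Embedding.inr C := rfl
    rw [this, Circuit.toMatrix, Circuit.toMatrix, ih, Gate.toMatrix_map_inr, tensor_mul, one_mul]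

lemma Synthesizable.tensor {k : ℕ} {U : Matrix (Bits (Fin m)) (Bits (Fin m)) ℂ}
    (h : Synthesizable k U) : Synthesizable k (tensor 1 U) := by
  obtain ⟨C, hC, hk⟩ := h
  exact ⟨C.map Function.Embedding.inr, by rw [Circuit.toMatrix_map_inr, hC],
    by rwa [Circuit.cnotCount_map]⟩

end Blocks

/-! ### Multiplexors and the block-ZXZ decomposition -/

section Multiplexors

variable {m : ℕ}

lemma tensor_one_eq_blocks (N : Matrix (Bits (Fin m)) (Bits (Fin m)) ℂ) :
    tensor 1 N = blocks N 0 0 N := by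
  simp [tensor_eq_blocks]

lemma multiplexor_mul (A B A' B' : Matrix (Bits (Fin m)) (Bits (Fin m)) ℂ) :
    multiplexor A B * multiplexor A' B' = multiplexor (A * A') (B * B') := by
  simp [multiplexor_eq_blocks, blocks_mul]

lemma blocks_diag_mem_unitaryGroup_iff {A B : Matrix (Bits (Fin m)) (Bits (Fin m)) ℂ} :
    blocks A 0 0 B ∈ Matrix.unitaryGroup (Bits (Fin 1 ⊕ Fin m)) ℂ ↔
      A ∈ Matrix.unitaryGroup (Bits (Fin m)) ℂ ∧ B ∈ Matrix.unitaryGroup (Bits (Fin m)) ℂ := by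
  simp only [mem_unitaryGroup_iff, star_eq_conjTranspose, blocks_conjTranspose, blocks_mul]
  rw [← blocks_one, blocks_inj]
  simp

lemma multiplexor_mem_unitaryGroup {A B : Matrix (Bits (Fin m)) (Bits (Fin m)) ℂ}
    (hA : A ∈ Matrix.unitaryGroup (Bits (Fin m)) ℂ)
    (hB : B ∈ Matrix.unitaryGroup (Bits (Fin m)) ℂ) :
    multiplexor A B ∈ Matrix.unitaryGroup (Bits (Fin 1 ⊕ Fin m)) ℂ := by
  rw [multiplexor_eq_blocks]
  exact blocks_diag_mem_unitaryGroup_iff.mpr ⟨hA, hB⟩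

lemma unitary_mul_conjTranspose {n : Type*} [Fintype n] [DecidableEq n] {U : Matrix n n ℂ}
    (hU : U ∈ Matrix.unitaryGroup n ℂ) : U * Uᴴ = 1 := mem_unitaryGroup_iff.mp hU

lemma unitary_conjTranspose_mul {n : Type*} [Fintype n] [DecidableEq n] {U : Matrix n n ℂ}
    (hU : U ∈ Matrix.unitaryGroup n ℂ) : Uᴴ * U = 1 := mem_unitaryGroup_iff'.mp hU

/-- The multiplexor of two unitaries is a uniformly controlled rotation of the ancilla between two
unitaries of the system, found by diagonalizing `A₁ * A₂ᴴ`. -/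
lemma exists_demultiplexing {A₁ A₂ : Matrix (Bits (Fin m)) (Bits (Fin m)) ℂ}
    (h₁ : A₁ ∈ Matrix.unitaryGroup (Bits (Fin m)) ℂ)
    (h₂ : A₂ ∈ Matrix.unitaryGroup (Bits (Fin m)) ℂ) :
    ∃ V ∈ Matrix.unitaryGroup (Bits (Fin m)) ℂ, ∃ W ∈ Matrix.unitaryGroup (Bits (Fin m)) ℂ,
      ∃ φ : Bits (Fin m) → ℝ, multiplexor A₁ A₂ = tensor 1 V * ucrz φ * tensor 1 W := by
  obtain ⟨V, hV, d, hd, hVd⟩ := exists_unitary_diagonalization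
    (mul_mem h₁ (Unitary.star_mem h₂))
  rw [star_eq_conjTranspose] at hVd
  let φ : Bits (Fin m) → ℝ := fun j => (d j).arg
  let D := diagonal fun j => Complex.exp (Complex.I * (φ j / 2))
  let D' := diagonal fun j => Complex.exp (-(Complex.I * (φ j / 2)))
  have hDD' : D * D' = 1 := by
    rw [diagonal_mul_diagonal, ← diagonal_one]
    congr 1
    ext j
    rw [← Complex.exp_add, add_neg_cancel, Complex.exp_zero]
  have hD'D : D' * D = 1 := by
    rw [diagonal_mul_diagonal, ← diagonal_one]
    congr 1
    ext j
    rw [← Complex.exp_add, neg_add_cancel, Complex.exp_zero]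
  have hD2 : D * D = diagonal d := by
    rw [diagonal_mul_diagonal]
    congr 1
    ext j
    rw [← Complex.exp_add]
    conv_rhs => rw [← Complex.norm_mul_exp_arg_mul_I (d j), hd j, Complex.ofReal_one, one_mul]
    congr 1
    simp only [φ]
    ring
  have hD : D ∈ Matrix.unitaryGroup (Bits (Fin m)) ℂ := by
    refine diagonal_mem_unitaryGroup fun j => ?_
    rw [Complex.norm_exp]
    simp
  have hV1 := unitary_mul_conjTranspose hV
  have hV2 := unitary_conjTranspose_mul hV
  have h21 := unitary_conjTranspose_mul h₂
  -- `A₁ = V D² Vᴴ A₂`, so both blocks are recovered from `W = D Vᴴ A₂`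
  have hA₁ : A₁ = V * (D * D) * Vᴴ * A₂ := by
    rw [hD2, ← hVd, mul_assoc, h21, mul_one]
  refine ⟨V, hV, D * Vᴴ * A₂, mul_mem (mul_mem hD (Unitary.star_mem hV)) h₂, φ, ?_⟩
  rw [multiplexor_eq_blocks, tensor_one_eq_blocks, tensor_one_eq_blocks, ucrz_eq_blocks,
    blocks_mul, blocks_mul]
  simp only [mul_zero, zero_mul, add_zero, zero_add]
  change _ = blocks (V * D * (D * Vᴴ * A₂)) 0 0 (V * D' * (D * Vᴴ * A₂))
  rw [blocks_inj]
  refine ⟨?_, rfl, rfl, ?_⟩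
  · rw [hA₁]; simp only [mul_assoc]
  · rw [show V * D' * (D * Vᴴ * A₂) = V * (D' * D) * Vᴴ * A₂ by simp only [mul_assoc], hD'D,
      mul_one, hV1, one_mul]

lemma hMatrix_mul_self : hMatrix * hMatrix = 1 := by
  have h := unitary_mul_conjTranspose hMatrix_mem_unitaryGroup
  have : hMatrixᴴ = hMatrix := by
    ext i j
    fin_cases i <;> fin_cases j <;> simp [hMatrix]
  rwa [this] at h

/-- The Hadamard gate on the ancilla as a matrix of the whole register. -/
noncomputable def ancillaHadamard (m : ℕ) :
    Matrix (Bits (Fin 1 ⊕ Fin m)) (Bits (Fin 1 ⊕ Fin m)) ℂ :=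
  tensor hMatrix 1

lemma ancillaHadamard_mul_self : ancillaHadamard m * ancillaHadamard m = 1 := by
  rw [ancillaHadamard, tensor_mul, hMatrix_mul_self, one_mul, tensor_one]

lemma ancillaHadamard_mem_unitaryGroup :
    ancillaHadamard m ∈ Matrix.unitaryGroup (Bits (Fin 1 ⊕ Fin m)) ℂ :=
  tensor_mem_unitaryGroup hMatrix_mem_unitaryGroup (one_mem _)

lemma ancillaHadamard_mul_tensor_one (N : Matrix (Bits (Fin m)) (Bits (Fin m)) ℂ) :
    ancillaHadamard m * tensor 1 N = tensor 1 N * ancillaHadamard m := by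
  simp [ancillaHadamard, tensor_mul]

lemma hadamard_conj_multiplexor (A B : Matrix (Bits (Fin m)) (Bits (Fin m)) ℂ) :
    ancillaHadamard m * multiplexor A B * ancillaHadamard m =
      blocks ((1 / 2 : ℂ) • (A + B)) ((1 / 2 : ℂ) • (A - B))
        ((1 / 2 : ℂ) • (A - B)) ((1 / 2 : ℂ) • (A + B)) := by
  have h : ((Real.sqrt 2 : ℝ) : ℂ)⁻¹ * ((Real.sqrt 2 : ℝ) : ℂ)⁻¹ = 1 / 2 := by
    rw [← mul_inv, ← Complex.ofReal_mul, Real.mul_self_sqrt (by norm_num)]; norm_num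
  rw [ancillaHadamard, multiplexor_eq_blocks, tensor_eq_blocks, blocks_mul, blocks_mul,
    blocks_inj]
  simp only [hMatrix, one_div, Complex.ofReal_inv, Matrix.smul_apply, of_apply, cons_val',
    cons_val_zero, cons_val_one, cons_val_fin_one, smul_eq_mul, mul_one, mul_neg, neg_smul, smul_mul_assoc,
    one_mul, mul_zero, add_zero, zero_add, mul_smul_comm, smul_smul, h, neg_mul, smul_add,
    smul_neg, neg_neg, sub_eq_add_neg, and_self]

/-- The block-ZXZ decomposition: in block form the right-hand side is
`½ [[A₁ (1 + B), A₁ (1 - B) C], [A₂ (1 - B), A₂ (1 + B) C]]`. -/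
lemma exists_block_zxz {U : Matrix (Bits (Fin 1 ⊕ Fin m)) (Bits (Fin 1 ⊕ Fin m)) ℂ}
    (hU : U ∈ Matrix.unitaryGroup (Bits (Fin 1 ⊕ Fin m)) ℂ) :
    ∃ A₁ ∈ Matrix.unitaryGroup (Bits (Fin m)) ℂ, ∃ A₂ ∈ Matrix.unitaryGroup (Bits (Fin m)) ℂ,
    ∃ B ∈ Matrix.unitaryGroup (Bits (Fin m)) ℂ, ∃ C ∈ Matrix.unitaryGroup (Bits (Fin m)) ℂ,
      U = multiplexor A₁ A₂ * (ancillaHadamard m * multiplexor 1 B * ancillaHadamard m) *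
        multiplexor 1 C := by
  obtain ⟨X, Y, Z, T, hXYZT⟩ := exists_eq_blocks U
  have hUU := unitary_mul_conjTranspose hU
  rw [hXYZT, blocks_conjTranspose, blocks_mul, ← blocks_one, blocks_inj] at hUU
  obtain ⟨hXY, -, hZT, -⟩ := hUU
  obtain ⟨P, hP, Q, hQ, c, -, hX⟩ := exists_singular_value_decomposition X
  have hP1 := unitary_mul_conjTranspose hP
  have hP2 := unitary_conjTranspose_mul hP
  have hQ1 := unitary_mul_conjTranspose hQ
  -- the rows of `Pᴴ Y` are orthogonal, with squared lengths `1 - c²`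
  have hY : (Pᴴ * Y) * (Pᴴ * Y)ᴴ = diagonal fun j => ((1 - c j ^ 2 : ℝ) : ℂ) := by
    have hYY : Y * Yᴴ = 1 - X * Xᴴ := eq_sub_of_add_eq' hXY
    have hXX : X * Xᴴ = P * diagonal (fun j => ((c j ^ 2 : ℝ) : ℂ)) * Pᴴ := by
      have hcc : diagonal (fun j => (c j : ℂ)) * (diagonal (fun j => (c j : ℂ)))ᴴ =
          diagonal (fun j => ((c j ^ 2 : ℝ) : ℂ)) := by
        rw [diagonal_conjTranspose, diagonal_mul_diagonal]
        congr 1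
        ext j
        simp [sq]
      rw [hX, conjTranspose_mul, conjTranspose_mul, ← hcc,
        show P * diagonal (fun j => (c j : ℂ)) * Q *
          (Qᴴ * ((diagonal (fun j => (c j : ℂ)))ᴴ * Pᴴ)) =
          P * diagonal (fun j => (c j : ℂ)) * (Q * Qᴴ) *
          ((diagonal (fun j => (c j : ℂ)))ᴴ * Pᴴ) by simp only [mul_assoc], hQ1]
      simp only [mul_assoc, one_mul]
    rw [conjTranspose_mul, conjTranspose_conjTranspose,
      show Pᴴ * Y * (Yᴴ * P) = Pᴴ * (Y * Yᴴ) * P by simp only [mul_assoc], hYY, hXX, mul_sub,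
      sub_mul, mul_one, hP2,
      show Pᴴ * (P * diagonal (fun j => ((c j ^ 2 : ℝ) : ℂ)) * Pᴴ) * P =
        (Pᴴ * P) * diagonal (fun j => ((c j ^ 2 : ℝ) : ℂ)) * (Pᴴ * P) by simp only [mul_assoc],
      hP2, one_mul, mul_one, ← diagonal_one, diagonal_sub]
    congr 1
    ext j
    simp
  have hc : ∀ j, 0 ≤ 1 - c j ^ 2 := by
    intro j
    have h := congrFun (congrFun hY j) j
    rw [diagonal_apply_eq, mul_apply] at h
    have h2 : ((∑ k, ‖(Pᴴ * Y) j k‖ ^ 2 : ℝ) : ℂ) = ((1 - c j ^ 2 : ℝ) : ℂ) := by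
      rw [← h, Complex.ofReal_sum]
      refine Finset.sum_congr rfl fun k _ => ?_
      rw [conjTranspose_apply, RCLike.star_def, Complex.mul_conj', Complex.ofReal_pow]
    rw [← Complex.ofReal_injective h2]
    positivity
  let s : Bits (Fin m) → ℝ := fun j => Real.sqrt (1 - c j ^ 2)
  have hcs : ∀ j, (c j : ℂ) ^ 2 + (s j : ℂ) ^ 2 = 1 := by
    intro j
    have := Real.sq_sqrt (hc j)
    rw [← Complex.ofReal_pow, ← Complex.ofReal_pow, ← Complex.ofReal_add, this]
    simp
  obtain ⟨R, hR, hYR⟩ := exists_eq_diagonal_mul_unitary (M := Pᴴ * Y) (s := s) (by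
    rw [hY]
    congr 1
    ext j
    rw [← Complex.ofReal_pow, Real.sq_sqrt (hc j)])
  have hY' : Y = P * diagonal (fun j => (s j : ℂ)) * R := by
    rw [mul_assoc, ← hYR, ← mul_assoc, hP1, one_mul]
  let E := diagonal fun j => (c j : ℂ) + Complex.I * s j
  let F := diagonal fun j => ((c j : ℂ) - Complex.I * s j) ^ 2
  have hnorm : ∀ j, ‖(c j : ℂ) + Complex.I * s j‖ = 1 ∧ ‖(c j : ℂ) - Complex.I * s j‖ = 1 := by
    intro j
    have h : c j ^ 2 + s j ^ 2 = 1 := by exact_mod_cast hcs j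
    constructor <;>
    · rw [← sq_eq_sq₀ (norm_nonneg _) zero_le_one, Complex.sq_norm, Complex.normSq_apply]
      simp
      linarith
  have hE : E ∈ Matrix.unitaryGroup (Bits (Fin m)) ℂ :=
    diagonal_mem_unitaryGroup fun j => (hnorm j).1
  have hF : F ∈ Matrix.unitaryGroup (Bits (Fin m)) ℂ :=
    diagonal_mem_unitaryGroup fun j => by rw [norm_pow, (hnorm j).2, one_pow]
  have hEF : E * F = diagonal fun j => (c j : ℂ) - Complex.I * s j := by
    rw [diagonal_mul_diagonal]
    congr 1
    ext j
    linear_combination ((c j : ℂ) - Complex.I * s j) * (hcs j - s j ^ 2 * Complex.I_sq)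
  let A := P * E * Q
  let B := Qᴴ * F * Q
  let C := (-Complex.I) • (Qᴴ * R)
  have hA : A ∈ Matrix.unitaryGroup (Bits (Fin m)) ℂ := mul_mem (mul_mem hP hE) hQ
  have hB : B ∈ Matrix.unitaryGroup (Bits (Fin m)) ℂ :=
    mul_mem (mul_mem (Unitary.star_mem hQ) hF) hQ
  have hC : C ∈ Matrix.unitaryGroup (Bits (Fin m)) ℂ := by
    have h := unitary_mul_conjTranspose (mul_mem (Unitary.star_mem hQ) hR)
    rw [star_eq_conjTranspose] at h
    rw [mem_unitaryGroup_iff, star_eq_conjTranspose, conjTranspose_smul, smul_mul_smul_comm, h]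
    simp
  have hAB : A * B = P * (E * F) * Q := by
    simp only [A, B]
    rw [show P * E * Q * (Qᴴ * F * Q) = P * E * (Q * Qᴴ) * (F * Q) by simp only [mul_assoc], hQ1]
    simp only [mul_assoc, one_mul]
  have hX2 : A * ((1 / 2 : ℂ) • (1 + B)) = X := by
    rw [mul_smul_comm, mul_add, mul_one, hAB, hX, hEF, ← add_mul, ← mul_add, diagonal_add,
      ← smul_mul_assoc, ← mul_smul_comm, ← diagonal_smul]
    congr 3
    ext j
    simp only [Pi.smul_apply, smul_eq_mul]
    ring
  have hY1 : A * ((1 / 2 : ℂ) • (1 - B)) = P * diagonal (fun j => Complex.I * (s j : ℂ)) * Q := by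
    rw [mul_smul_comm, mul_sub, mul_one, hAB, hEF, ← sub_mul, ← mul_sub, diagonal_sub,
      ← smul_mul_assoc, ← mul_smul_comm, ← diagonal_smul]
    congr 3
    ext j
    simp only [Pi.smul_apply, smul_eq_mul]
    ring
  have hY2 : A * ((1 / 2 : ℂ) • (1 - B)) * C = Y := by
    rw [hY1, hY', mul_smul_comm, mul_assoc _ Q, ← mul_assoc Q, hQ1, one_mul, ← smul_mul_assoc,
      ← mul_smul_comm, ← diagonal_smul]
    congr 3
    ext j
    simp only [Pi.smul_apply, smul_eq_mul]
    linear_combination (-(s j : ℂ)) * Complex.I_sq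
  -- `M` has the same upper half as `U`, so that `U * Mᴴ` is block diagonal
  let M := multiplexor A 1 * (ancillaHadamard m * multiplexor 1 B * ancillaHadamard m) *
    multiplexor 1 C
  have hM : M ∈ Matrix.unitaryGroup (Bits (Fin 1 ⊕ Fin m)) ℂ :=
    mul_mem (mul_mem (multiplexor_mem_unitaryGroup hA (one_mem _)) (mul_mem (mul_mem
      ancillaHadamard_mem_unitaryGroup (multiplexor_mem_unitaryGroup (one_mem _) hB))
      ancillaHadamard_mem_unitaryGroup)) (multiplexor_mem_unitaryGroup (one_mem _) hC)
  obtain ⟨Z', T', hMb⟩ : ∃ Z' T', M = blocks X Y Z' T' := by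
    refine ⟨(1 / 2 : ℂ) • (1 - B), ((1 / 2 : ℂ) • (1 + B)) * C, ?_⟩
    simp only [M]
    rw [hadamard_conj_multiplexor, multiplexor_eq_blocks, multiplexor_eq_blocks, blocks_mul,
      blocks_mul, blocks_inj]
    simp only [zero_mul, mul_zero, add_zero, zero_add, one_mul, mul_one, hX2, hY2, and_self]
  have hMM := unitary_mul_conjTranspose hM
  rw [hMb, blocks_conjTranspose, blocks_mul, ← blocks_one, blocks_inj] at hMM
  have hUM : U * Mᴴ = blocks 1 0 0 (Z * Z'ᴴ + T * T'ᴴ) := by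
    rw [hMb, hXYZT, blocks_conjTranspose, blocks_mul, hXY, hMM.2.1, hZT]
  have hA₂ : Z * Z'ᴴ + T * T'ᴴ ∈ Matrix.unitaryGroup (Bits (Fin m)) ℂ := by
    have : U * Mᴴ ∈ Matrix.unitaryGroup (Bits (Fin 1 ⊕ Fin m)) ℂ :=
      mul_mem hU (Unitary.star_mem hM)
    rw [hUM] at this
    exact (blocks_diag_mem_unitaryGroup_iff.mp this).2
  refine ⟨A, hA, _, hA₂, B, hB, C, hC, ?_⟩
  calc U = U * Mᴴ * M := by rw [mul_assoc, unitary_conjTranspose_mul hM, mul_one]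
    _ = _ := by
      rw [hUM, ← multiplexor_eq_blocks]
      simp only [M, ← mul_assoc, multiplexor_mul, one_mul, mul_one]

end Multiplexors

/-! ### Uniformly controlled rotations -/

section UniformlyControlled

variable {m : ℕ}

lemma Rz_mem_unitaryGroup (φ : ℝ) : Rz φ ∈ Matrix.unitaryGroup (Fin 2) ℂ := by
  rw [mem_unitaryGroup_iff, star_eq_conjTranspose]
  ext i j
  fin_cases i <;> fin_cases j <;>
    simp [Rz, mul_apply, Fin.sum_univ_two, ← Complex.exp_conj, ← Complex.exp_add,
      Complex.conj_ofNat]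

lemma ucrz_mul (φ ψ : Bits (Fin m) → ℝ) : ucrz φ * ucrz ψ = ucrz (φ + ψ) := by
  simp only [ucrz_eq_blocks, blocks_mul, diagonal_mul_diagonal, ← Complex.exp_add, mul_zero,
    zero_mul, add_zero, zero_add]
  rw [blocks_inj]
  refine ⟨?_, rfl, rfl, ?_⟩ <;>
  · congr 1
    ext j
    congr 1
    simp only [Pi.add_apply, Complex.ofReal_add]
    ring

lemma ucrz_const (t : ℝ) : ucrz (fun _ : Bits (Fin m) => t) = tensor (Rz t) 1 := by
  rw [ucrz_eq_blocks, tensor_eq_blocks]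
  simp [Rz, smul_one_eq_diagonal]

lemma ancillaCnot_mul_self (q : Fin m) :
    (ancillaCnot q).toMatrix * (ancillaCnot q).toMatrix = 1 := by
  rw [ancillaCnot_toMatrix, blocks_mul, ← blocks_one, blocks_inj]
  simp only [diagonal_mul_diagonal, diagonal_add, ← diagonal_one, ← diagonal_zero,
    diagonal_eq_diagonal_iff]
  refine ⟨fun j => ?_, fun j => ?_, fun j => ?_, fun j => ?_⟩ <;>
  rcases Fin.exists_fin_two.mp ⟨j q, rfl⟩ with h | h <;> simp [h]

lemma ancillaCnot_comm (q r : Fin m) :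
    (ancillaCnot q).toMatrix * (ancillaCnot r).toMatrix =
      (ancillaCnot r).toMatrix * (ancillaCnot q).toMatrix := by
  simp only [ancillaCnot_toMatrix, blocks_mul, diagonal_mul_diagonal, diagonal_add, mul_comm]
  rw [blocks_inj]
  simp only [add_comm, and_self]

lemma ancillaCnot_conj_ucrz (q : Fin m) (φ : Bits (Fin m) → ℝ) :
    (ancillaCnot q).toMatrix * ucrz φ * (ancillaCnot q).toMatrix =
      ucrz fun j => if j q = 0 then φ j else -φ j := by
  rw [ucrz_eq_blocks, ucrz_eq_blocks, ancillaCnot_toMatrix, blocks_mul, blocks_mul, blocks_inj]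
  simp only [diagonal_mul_diagonal, diagonal_add, mul_zero, add_zero, zero_add, ← diagonal_zero,
    diagonal_eq_diagonal_iff]
  refine ⟨fun j => ?_, fun j => ?_, fun j => ?_, fun j => ?_⟩ <;>
  rcases Fin.exists_fin_two.mp ⟨j q, rfl⟩ with h | h <;> simp [h, neg_div]

/-- The C-NOT onto the ancilla controlled by the first qubit of a list, if there is one. -/
noncomputable def headCnot :
    List (Fin m) → Matrix (Bits (Fin 1 ⊕ Fin m)) (Bits (Fin 1 ⊕ Fin m)) ℂ
  | [] => 1
  | q :: _ => (ancillaCnot q).toMatrix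

lemma headCnot_mul_self (l : List (Fin m)) : headCnot l * headCnot l = 1 := by
  cases l
  · exact mul_one 1
  · exact ancillaCnot_mul_self _

lemma headCnot_comm (l : List (Fin m)) (q : Fin m) :
    headCnot l * (ancillaCnot q).toMatrix = (ancillaCnot q).toMatrix * headCnot l := by
  cases l
  · simp [headCnot]
  · exact ancillaCnot_comm _ _

/-- The value of `φ` depends only on the bits of the qubits in `l`. -/
def DependsOnlyOn (l : List (Fin m)) (φ : Bits (Fin m) → ℝ) : Prop :=
  ∀ i j : Bits (Fin m), (∀ q ∈ l, i q = j q) → φ i = φ j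

/-- A rotation with `k` controls needs `2 ^ k` C-NOTs, one of which can be placed at the far
right: `φ = α ± β` according to the value of the first control, the sign change is a conjugation
by a C-NOT, and the extreme C-NOTs of the rotations by `α` and `β` cancel. -/
lemma exists_ucrz_eq_mul_headCnot (l : List (Fin m)) :
    ∀ φ : Bits (Fin m) → ℝ, DependsOnlyOn l φ →
      ∃ K, Synthesizable (2 ^ l.length - 1) K ∧ ucrz φ = K * headCnot l := by
  induction l with
  | nil =>
    intro φ hφ
    refine ⟨ucrz φ, ?_, (mul_one _).symm⟩
    have : φ = fun _ => φ 0 := funext fun j => hφ _ _ (by simp)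
    rw [this, ucrz_const]
    exact synthesizable_tensor_one (Rz_mem_unitaryGroup _)
  | cons q l ih =>
    intro φ hφ
    let α : Bits (Fin m) → ℝ := fun j => (φ (Function.update j q 0) + φ (Function.update j q 1)) / 2
    let β : Bits (Fin m) → ℝ := fun j => (φ (Function.update j q 0) - φ (Function.update j q 1)) / 2
    have hup : ∀ b : Fin 2, DependsOnlyOn l fun j => φ (Function.update j q b) := by
      intro b i j hij
      refine hφ _ _ fun r hr => ?_
      rcases eq_or_ne r q with rfl | hrq
      · simp
      · rw [Function.update_of_ne hrq, Function.update_of_ne hrq]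
        exact hij r ((List.mem_cons.mp hr).resolve_left hrq)
    have hα : DependsOnlyOn l α := fun i j hij =>
      congrArg₂ (fun x y => (x + y) / 2) (hup 0 i j hij) (hup 1 i j hij)
    have hβ : DependsOnlyOn l β := fun i j hij =>
      congrArg₂ (fun x y => (x - y) / 2) (hup 0 i j hij) (hup 1 i j hij)
    obtain ⟨β', hβ', hββ'⟩ : ∃ β', DependsOnlyOn l β' ∧
        headCnot l * ucrz β * headCnot l = ucrz β' := by
      cases l with
      | nil => exact ⟨β, hβ, by simp [headCnot]⟩
      | cons r l =>
        refine ⟨_, fun i j hij => ?_, ancillaCnot_conj_ucrz r β⟩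
        simp only [hβ i j hij, hij r List.mem_cons_self]
    obtain ⟨K, hK, hKα⟩ := ih α hα
    obtain ⟨K', hK', hKβ⟩ := ih β' hβ'
    have hK'' : ucrz β = headCnot l * K' := by
      calc ucrz β = (headCnot l * headCnot l) * ucrz β * (headCnot l * headCnot l) := by
            rw [headCnot_mul_self, one_mul, mul_one]
        _ = headCnot l * (headCnot l * ucrz β * headCnot l) * headCnot l := by
            simp only [mul_assoc]
        _ = headCnot l * K' * (headCnot l * headCnot l) := by
            rw [hββ', hKβ]; simp only [mul_assoc]
        _ = headCnot l * K' := by rw [headCnot_mul_self, mul_one]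
    refine ⟨K * (ancillaCnot q).toMatrix * K', ?_, ?_⟩
    · refine ((hK.mul (synthesizable_cnot _)).mul hK').mono ?_
      have := Nat.one_le_two_pow (n := l.length)
      rw [List.length_cons, pow_succ]
      omega
    · have hsplit : ucrz φ =
          ucrz α * ((ancillaCnot q).toMatrix * ucrz β * (ancillaCnot q).toMatrix) := by
        rw [ancillaCnot_conj_ucrz, ucrz_mul]
        congr 1
        ext j
        simp only [Pi.add_apply, α, β]
        rcases Fin.exists_fin_two.mp ⟨j q, rfl⟩ with h | h
        · have : Function.update j q 0 = j := by rw [← h, Function.update_eq_self]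
          rw [if_pos h, this]
          ring
        · have : Function.update j q 1 = j := by rw [← h, Function.update_eq_self]
          rw [if_neg (by simp [h]), this]
          ring
      calc ucrz φ = K * headCnot l *
            ((ancillaCnot q).toMatrix * (headCnot l * K') * (ancillaCnot q).toMatrix) := by
            rw [hsplit, hKα, hK'']
        _ = K * (headCnot l * (ancillaCnot q).toMatrix) * headCnot l * K' *
            (ancillaCnot q).toMatrix := by simp only [mul_assoc]
        _ = K * (ancillaCnot q).toMatrix * (headCnot l * headCnot l) * K' *
            (ancillaCnot q).toMatrix := by rw [headCnot_comm]; simp only [mul_assoc]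
        _ = _ := by rw [headCnot_mul_self, mul_one]; rfl

lemma exists_ucrz_eq_mul_ancillaCnot (φ : Bits (Fin (m + 1)) → ℝ) :
    ∃ K, Synthesizable (2 ^ (m + 1) - 1) K ∧ ucrz φ = K * (ancillaCnot 0).toMatrix := by
  obtain ⟨K, hK, h⟩ := exists_ucrz_eq_mul_headCnot (List.finRange (m + 1)) φ
    fun i j hij => congrArg φ (funext fun q => hij q (List.mem_finRange q))
  rw [List.length_finRange] at hK
  rw [List.finRange_succ] at h
  exact ⟨K, hK, h⟩

lemma exists_ucrz_eq_ancillaCnot_mul (φ : Bits (Fin (m + 1)) → ℝ) :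
    ∃ K, Synthesizable (2 ^ (m + 1) - 1) K ∧ ucrz φ = (ancillaCnot 0).toMatrix * K := by
  have h := ancillaCnot_conj_ucrz 0 φ
  obtain ⟨K, hK, hK'⟩ :=
    exists_ucrz_eq_mul_ancillaCnot fun j : Bits (Fin (m + 1)) => if j 0 = 0 then φ j else -φ j
  refine ⟨K, hK, ?_⟩
  set c := (ancillaCnot (0 : Fin (m + 1))).toMatrix with hc
  have hcc : c * c = 1 := ancillaCnot_mul_self 0
  rw [← h] at hK'
  calc ucrz φ = c * (c * ucrz φ * c) * c := by
        rw [← mul_assoc, ← mul_assoc, hcc, one_mul, mul_assoc, hcc, mul_one]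
    _ = c * K := by rw [hK', mul_assoc, mul_assoc, hcc, mul_one]

lemma synthesizable_ucrz (φ : Bits (Fin m) → ℝ) : Synthesizable (2 ^ m) (ucrz φ) := by
  cases m with
  | zero =>
    have : φ = fun _ => φ 0 := funext fun j => congrArg φ (Subsingleton.elim _ _)
    rw [this, ucrz_const]
    exact (synthesizable_tensor_one (Rz_mem_unitaryGroup _)).mono (Nat.zero_le _)
  | succ m =>
    obtain ⟨K, hK, h⟩ := exists_ucrz_eq_mul_ancillaCnot φ
    rw [h]
    refine (hK.mul (synthesizable_cnot _)).mono ?_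
    have := Nat.one_le_two_pow (n := m + 1)
    omega

end UniformlyControlled

/-! ### One step of the recursion -/

section Recursion

variable {m : ℕ}

/-- A circuit with at most `k` C-NOTs implements `U` up to a diagonal unitary applied last. -/
def SynthesizableUpToDiagonal {Q : Type} [Fintype Q] [DecidableEq Q] (k : ℕ)
    (U : Matrix (Bits Q) (Bits Q) ℂ) : Prop :=
  ∃ δ : Bits Q → ℂ, (∀ j, ‖δ j‖ = 1) ∧ Synthesizable k (diagonal δ * U)

lemma tensor_diagonal_comm_ucrz (δ : Bits (Fin m) → ℂ) (φ : Bits (Fin m) → ℝ) :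
    Commute (tensor 1 (diagonal δ)) (ucrz φ) := by
  simp only [Commute, SemiconjBy, tensor_one_eq_blocks, ucrz_eq_blocks, blocks_mul,
    diagonal_mul_diagonal, mul_comm, zero_mul, mul_zero]

lemma tensor_diagonal_comm_ancillaCnot (δ : Bits (Fin m) → ℂ) (q : Fin m) :
    Commute (tensor 1 (diagonal δ)) (ancillaCnot q).toMatrix := by
  simp only [Commute, SemiconjBy, tensor_one_eq_blocks, ancillaCnot_toMatrix, blocks_mul,
    diagonal_mul_diagonal, mul_comm, zero_mul, mul_zero, add_zero, zero_add]

lemma tensor_diagonal_comm_ancillaHadamard (δ : Bits (Fin m) → ℂ) :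
    Commute (tensor 1 (diagonal δ)) (ancillaHadamard m) :=
  (ancillaHadamard_mul_tensor_one _).symm

lemma ancillaCnot_eq_hadamard_conj (q : Fin m) : (ancillaCnot q).toMatrix =
    ancillaHadamard m * multiplexor 1 (diagonal fun j => if j q = 0 then 1 else -1) *
      ancillaHadamard m := by
  rw [hadamard_conj_multiplexor, ancillaCnot_toMatrix, blocks_inj, ← diagonal_one]
  simp only [diagonal_add, diagonal_sub, ← diagonal_smul, diagonal_eq_diagonal_iff,
    Pi.smul_apply, smul_eq_mul]
  refine ⟨fun j => ?_, fun j => ?_, fun j => ?_, fun j => ?_⟩ <;>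
  rcases Fin.exists_fin_two.mp ⟨j q, rfl⟩ with h | h <;> norm_num [h]

/-- The C-NOTs at the inner ends of the outer rotations of a block-ZXZ decomposition become
controlled sign flips between the Hadamard gates and are absorbed by the central multiplexor. -/
lemma exists_absorb_ancillaCnot (q : Fin m) {W B V : Matrix (Bits (Fin m)) (Bits (Fin m)) ℂ}
    (hW : W ∈ Matrix.unitaryGroup (Bits (Fin m)) ℂ)
    (hB : B ∈ Matrix.unitaryGroup (Bits (Fin m)) ℂ)
    (hV : V ∈ Matrix.unitaryGroup (Bits (Fin m)) ℂ) :
    ∃ B₁ ∈ Matrix.unitaryGroup (Bits (Fin m)) ℂ, ∃ B₂ ∈ Matrix.unitaryGroup (Bits (Fin m)) ℂ,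
      (ancillaCnot q).toMatrix * tensor 1 W *
        (ancillaHadamard m * multiplexor 1 B * ancillaHadamard m) *
        (tensor 1 V * (ancillaCnot q).toMatrix) =
      ancillaHadamard m * multiplexor B₁ B₂ * ancillaHadamard m := by
  rw [ancillaCnot_eq_hadamard_conj]
  set Z : Matrix (Bits (Fin m)) (Bits (Fin m)) ℂ :=
    diagonal fun j => if j q = 0 then 1 else -1 with hZdef
  have hZ : Z ∈ Matrix.unitaryGroup (Bits (Fin m)) ℂ :=
    diagonal_mem_unitaryGroup fun j => by split_ifs <;> simp
  refine ⟨W * V, mul_mem hW hV, Z * (W * B * V) * Z,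
    mul_mem (mul_mem hZ (mul_mem (mul_mem hW hB) hV)) hZ, ?_⟩
  have hm : ∀ N : Matrix (Bits (Fin m)) (Bits (Fin m)) ℂ, tensor 1 N = multiplexor N N := by
    intro N; rw [tensor_one_eq_blocks, multiplexor_eq_blocks]
  set H := ancillaHadamard m with hH
  have hHH : H * H = 1 := ancillaHadamard_mul_self
  calc H * multiplexor 1 Z * H * tensor 1 W * (H * multiplexor 1 B * H) *
        (tensor 1 V * (H * multiplexor 1 Z * H))
      = H * multiplexor 1 Z * (H * tensor 1 W) * (H * multiplexor 1 B * (H * tensor 1 V)) *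
        (H * multiplexor 1 Z * H) := by simp only [mul_assoc]
    _ = H * multiplexor 1 Z * tensor 1 W * (H * H) * multiplexor 1 B * tensor 1 V * (H * H) *
        multiplexor 1 Z * H := by
        rw [hH, ancillaHadamard_mul_tensor_one, ancillaHadamard_mul_tensor_one]
        simp only [mul_assoc]
    _ = H * (multiplexor 1 Z * tensor 1 W * multiplexor 1 B * tensor 1 V *
        multiplexor 1 Z) * H := by rw [hHH]; simp only [mul_assoc, one_mul]
    _ = _ := by
        simp only [hm, multiplexor_mul, one_mul, mul_one, mul_assoc]

/-- A diagonal that commutes with `K` can be moved from the left of a synthesized factor `U` on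
the right of `K` to the left of `K`. -/
lemma SynthesizableUpToDiagonal.exists_mul_tensor_eq {k : ℕ}
    {U : Matrix (Bits (Fin m)) (Bits (Fin m)) ℂ} (h : SynthesizableUpToDiagonal k U)
    {K : Matrix (Bits (Fin 1 ⊕ Fin m)) (Bits (Fin 1 ⊕ Fin m)) ℂ}
    (hK : ∀ δ : Bits (Fin m) → ℂ, Commute (tensor 1 (diagonal δ)) K) :
    ∃ D ∈ Matrix.unitaryGroup (Bits (Fin m)) ℂ, ∃ S, Synthesizable k S ∧
      K * tensor 1 U = tensor 1 D * K * S := by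
  obtain ⟨δ, hδ, hS⟩ := h
  have hD : diagonal δ ∈ Matrix.unitaryGroup (Bits (Fin m)) ℂ := diagonal_mem_unitaryGroup hδ
  refine ⟨_, Unitary.star_mem hD, _, hS.tensor, ?_⟩
  rw [star_eq_conjTranspose, diagonal_conjTranspose, (hK _).eq, mul_assoc, tensor_mul, one_mul,
    ← mul_assoc, ← diagonal_conjTranspose, unitary_conjTranspose_mul hD, one_mul]

/-- Block-ZXZ decomposition followed by demultiplexing, with the diagonals of the three inner
system unitaries pushed to the left and two C-NOTs absorbed. -/
lemma exists_tensor_mul_synthesizable {k : ℕ}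
    (hk : ∀ V ∈ Matrix.unitaryGroup (Bits (Fin (m + 1))) ℂ, SynthesizableUpToDiagonal k V)
    {U : Matrix (Bits (Fin 1 ⊕ Fin (m + 1))) (Bits (Fin 1 ⊕ Fin (m + 1))) ℂ}
    (hU : U ∈ Matrix.unitaryGroup (Bits (Fin 1 ⊕ Fin (m + 1))) ℂ) :
    ∃ V ∈ Matrix.unitaryGroup (Bits (Fin (m + 1))) ℂ, ∃ K,
      Synthesizable (3 * k + 3 * 2 ^ (m + 1) - 2) K ∧ U = tensor 1 V * K := by
  obtain ⟨A₁, hA₁, A₂, hA₂, B, hB, C, hC, hUABC⟩ := exists_block_zxz hU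
  obtain ⟨V₁, hV₁, W₁, hW₁, φ₁, h₁⟩ := exists_demultiplexing hA₁ hA₂
  obtain ⟨V₃, hV₃, W₃, hW₃, φ₃, h₃⟩ := exists_demultiplexing (one_mem _) hC
  obtain ⟨K₁, hK₁, hφ₁⟩ := exists_ucrz_eq_mul_ancillaCnot φ₁
  obtain ⟨K₃, hK₃, hφ₃⟩ := exists_ucrz_eq_ancillaCnot_mul φ₃
  obtain ⟨B₁, hB₁, B₂, hB₂, hmid⟩ := exists_absorb_ancillaCnot 0 hW₁ hB hV₃
  obtain ⟨V₂, hV₂, W₂, hW₂, φ₂, h₂⟩ := exists_demultiplexing hB₁ hB₂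
  set c := (ancillaCnot (0 : Fin (m + 1))).toMatrix with hc
  have hcc : c * c = 1 := ancillaCnot_mul_self 0
  set H := ancillaHadamard (m + 1) with hH
  have hUfac : U = tensor 1 V₁ * K₁ * H * (tensor 1 V₂ * ucrz φ₂ * tensor 1 W₂) * H * K₃ *
      tensor 1 W₃ := by
    rw [hUABC, h₁, h₃, hφ₁, hφ₃, ← h₂]
    calc _ = tensor 1 V₁ * K₁ * (c * tensor 1 W₁ * (H * multiplexor 1 B * H) *
          (tensor 1 V₃ * c)) * K₃ * tensor 1 W₃ := by simp only [mul_assoc]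
      _ = _ := by rw [hmid]; simp only [mul_assoc]
  have hcomm₁ : ∀ δ, Commute (tensor 1 (diagonal δ)) (K₁ * H) := by
    intro δ
    have : K₁ = ucrz φ₁ * c := by rw [hφ₁, mul_assoc, hcc, mul_one]
    rw [this]
    exact ((tensor_diagonal_comm_ucrz δ φ₁).mul_right
      (tensor_diagonal_comm_ancillaCnot δ 0)).mul_right (tensor_diagonal_comm_ancillaHadamard δ)
  have hcomm₃ : ∀ δ, Commute (tensor 1 (diagonal δ)) (H * K₃) := by
    intro δ
    have : K₃ = c * ucrz φ₃ := by rw [hφ₃, ← mul_assoc, hcc, one_mul]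
    rw [this]
    exact (tensor_diagonal_comm_ancillaHadamard δ).mul_right
      ((tensor_diagonal_comm_ancillaCnot δ 0).mul_right (tensor_diagonal_comm_ucrz δ φ₃))
  obtain ⟨D₃, hD₃, S₃, hS₃, e₃⟩ := (hk W₃ hW₃).exists_mul_tensor_eq hcomm₃
  obtain ⟨D₂, hD₂, S₂, hS₂, e₂⟩ := (hk (W₂ * D₃) (mul_mem hW₂ hD₃)).exists_mul_tensor_eq
    fun δ => tensor_diagonal_comm_ucrz δ φ₂
  obtain ⟨D₁, hD₁, S₁, hS₁, e₁⟩ := (hk (V₂ * D₂) (mul_mem hV₂ hD₂)).exists_mul_tensor_eq hcomm₁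
  have hHsyn : Synthesizable 0 H := synthesizable_tensor_one hMatrix_mem_unitaryGroup
  refine ⟨V₁ * D₁, mul_mem hV₁ hD₁, K₁ * H * S₁ * ucrz φ₂ * S₂ * (H * K₃) * S₃, ?_, ?_⟩
  · refine ((((((hK₁.mul hHsyn).mul hS₁).mul (synthesizable_ucrz φ₂)).mul hS₂).mul
      (hHsyn.mul hK₃)).mul hS₃).mono ?_
    have := Nat.one_le_two_pow (n := m + 1)
    omega
  · have ht : ∀ M N : Matrix (Bits (Fin (m + 1))) (Bits (Fin (m + 1))) ℂ,
        tensor 1 (M * N) = tensor 1 M * tensor 1 N := fun M N => by rw [tensor_mul, one_mul]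
    calc U = tensor 1 V₁ * (K₁ * H) * tensor 1 V₂ * ucrz φ₂ * tensor 1 W₂ *
          (H * K₃ * tensor 1 W₃) := by rw [hUfac]; simp only [mul_assoc]
      _ = tensor 1 V₁ * (K₁ * H) * tensor 1 V₂ * (ucrz φ₂ * tensor 1 (W₂ * D₃)) *
          (H * K₃) * S₃ := by rw [e₃, ht]; simp only [mul_assoc]
      _ = tensor 1 V₁ * ((K₁ * H) * tensor 1 (V₂ * D₂)) * ucrz φ₂ * S₂ * (H * K₃) * S₃ := by
          rw [e₂, ht]; simp only [mul_assoc]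
      _ = _ := by rw [e₁, ht]; simp only [mul_assoc]

lemma tensor_one_diagonal (δ : Bits (Fin m) → ℂ) :
    tensor 1 (diagonal δ) = diagonal fun x : Bits (Fin 1 ⊕ Fin m) => δ fun i => x (Sum.inr i) := by
  rw [tensor, ← diagonal_one, diagonal_kronecker_diagonal, submatrix_diagonal_equiv]
  congr 1
  ext x
  simp only [Function.comp_apply, one_mul]
  rfl

lemma SynthesizableUpToDiagonal.of_equiv {Q Q' : Type} [Fintype Q] [DecidableEq Q] [Fintype Q']
    [DecidableEq Q'] (e : Q ≃ Q') {k : ℕ} {U : Matrix (Bits Q') (Bits Q') ℂ}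
    (h : SynthesizableUpToDiagonal k (U.submatrix (e.arrowCongr (Equiv.refl (Fin 2)))
      (e.arrowCongr (Equiv.refl (Fin 2))))) : SynthesizableUpToDiagonal k U := by
  obtain ⟨δ, hδ, h⟩ := h
  refine ⟨δ ∘ (e.arrowCongr (Equiv.refl (Fin 2))).symm, fun j => hδ _, .of_equiv e ?_⟩
  rw [← submatrix_mul_equiv _ _ _ (e.arrowCongr (Equiv.refl (Fin 2))), submatrix_diagonal_equiv]
  rw [Function.comp_assoc, Equiv.symm_comp_self, Function.comp_id]
  exact h

lemma submatrix_equiv_mem_unitaryGroup {n n' : Type*} [Fintype n] [DecidableEq n] [Fintype n']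
    [DecidableEq n'] (e : n ≃ n') {U : Matrix n' n' ℂ} (hU : U ∈ Matrix.unitaryGroup n' ℂ) :
    U.submatrix e e ∈ Matrix.unitaryGroup n ℂ := by
  rw [mem_unitaryGroup_iff, star_eq_conjTranspose, conjTranspose_submatrix, submatrix_mul_equiv,
    unitary_mul_conjTranspose hU, submatrix_one_equiv]

/-- The recursion for the number of C-NOTs. The saving of the diagonal form propagates to the
exact form because only the leftmost of the four system unitaries has to be exact. -/
lemma synthesis_succ {k l : ℕ}
    (hk : ∀ V ∈ Matrix.unitaryGroup (Bits (Fin (m + 1))) ℂ, SynthesizableUpToDiagonal k V)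
    (hl : ∀ V ∈ Matrix.unitaryGroup (Bits (Fin (m + 1))) ℂ, Synthesizable l V)
    {U : Matrix (Bits (Fin (m + 2))) (Bits (Fin (m + 2))) ℂ}
    (hU : U ∈ Matrix.unitaryGroup (Bits (Fin (m + 2))) ℂ) :
    SynthesizableUpToDiagonal (k + (3 * k + 3 * 2 ^ (m + 1) - 2)) U ∧
      Synthesizable (l + (3 * k + 3 * 2 ^ (m + 1) - 2)) U := by
  let e : Fin 1 ⊕ Fin (m + 1) ≃ Fin (m + 2) := finSumFinEquiv.trans (finCongr (by omega))
  obtain ⟨V, hV, K, hK, hVK⟩ := exists_tensor_mul_synthesizable hk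
    (submatrix_equiv_mem_unitaryGroup (e.arrowCongr (Equiv.refl (Fin 2))) hU)
  refine ⟨.of_equiv e ?_, .of_equiv e ?_⟩
  · obtain ⟨δ, hδ, hS⟩ := hk V hV
    refine ⟨fun x => δ fun i => x (Sum.inr i), fun j => hδ _, ?_⟩
    rw [← tensor_one_diagonal, hVK, ← mul_assoc, tensor_mul, one_mul]
    exact hS.tensor.mul hK
  · rw [hVK]
    exact (hl V hV).tensor.mul hK

end Recursion

/-! ### Real orthogonal factors of a unitary matrix -/

section RealOrthogonal

variable {n : Type*} [Fintype n] [DecidableEq n]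

/-- Induction over the orthogonal group, which is generated by the reflections `1 - 2 v vᵀ`. -/
lemma orthogonal_induction {p : Matrix n n ℝ → Prop} (one : p 1)
    (reflection_mul : ∀ v : n → ℝ, ∑ i, v i ^ 2 = 1 → ∀ O, p O →
      p ((1 - (2 : ℝ) • vecMulVec v v) * O))
    {O : Matrix n n ℝ} (hO : O ∈ Matrix.unitaryGroup n ℝ) : p O := by
  let T := toEuclideanCLM (n := n) (𝕜 := ℝ)
  have hTO : T O ∈ unitary (EuclideanSpace ℝ n →L[ℝ] EuclideanSpace ℝ n) := by
    rw [Unitary.mem_iff, ← map_star, ← map_mul, ← map_mul, mem_unitaryGroup_iff.mp hO,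
      mem_unitaryGroup_iff'.mp hO, map_one]
    exact ⟨rfl, rfl⟩
  have key : ∀ l : List (EuclideanSpace ℝ n), p (T.symm
      (Unitary.linearIsometryEquiv.symm (l.map fun v => (ℝ ∙ v)ᗮ.reflection).prod).1) := by
    intro l
    induction l with
    | nil => simpa using one
    | cons v l ih =>
      rw [List.map_cons, List.prod_cons, map_mul, Submonoid.coe_mul, map_mul]
      by_cases hv : v = 0
      · have : (ℝ ∙ v)ᗮ.reflection = 1 := by
          ext1 x
          rw [Submodule.reflection_orthogonal_apply, Submodule.reflection_singleton_apply, hv]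
          simp
        rw [this, map_one, Submonoid.coe_one, map_one, one_mul]
        exact ih
      · have hv' : ‖v‖ ≠ 0 := norm_ne_zero_iff.mpr hv
        have hsum : ∑ i, v i ^ 2 = ‖v‖ ^ 2 := by
          rw [EuclideanSpace.norm_sq_eq]
          simp
        have hrefl : T.symm (Unitary.linearIsometryEquiv.symm (ℝ ∙ v)ᗮ.reflection).1 =
            1 - (2 : ℝ) • vecMulVec (fun i => v i / ‖v‖) (fun i => v i / ‖v‖) := by
          rw [StarAlgEquiv.symm_apply_eq]
          ext1 x
          rw [Unitary.coe_symm_linearIsometryEquiv_apply]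
          change (ℝ ∙ v)ᗮ.reflection x = _
          rw [Submodule.reflection_orthogonal_apply, Submodule.reflection_singleton_apply]
          ext i
          rw [ofLp_toEuclideanCLM, sub_mulVec, smul_mulVec, vecMulVec_mulVec]
          simp only [PiLp.sub_apply, PiLp.smul_apply, smul_eq_mul,
            PiLp.inner_apply, one_mulVec, Pi.sub_apply, Pi.smul_apply, dotProduct,
            RCLike.inner_apply, conj_trivial, RCLike.ofReal_real_eq_id, id, neg_sub]
          have : ∑ j, v j / ‖v‖ * x j = (∑ j, x j * v j) / ‖v‖ := by
            rw [Finset.sum_div]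
            exact Finset.sum_congr rfl fun j _ => by ring
          rw [this]
          simp only [nsmul_eq_mul, MulOpposite.smul_eq_mul_unop, MulOpposite.unop_op]
          push_cast
          field_simp
        rw [hrefl]
        refine reflection_mul _ ?_ _ ih
        simp only [div_pow]
        rw [← Finset.sum_div, hsum, div_self (pow_ne_zero 2 hv')]
  obtain ⟨l, -, hl⟩ := (Unitary.linearIsometryEquiv ⟨T O, hTO⟩).reflections_generate_dim
  have := key l
  rw [← hl] at this
  simpa using this

/-- The real orthogonal matrices, as complex matrices. -/
def IsRealOrthogonal (M : Matrix n n ℂ) : Prop :=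
  ∃ O ∈ Matrix.unitaryGroup n ℝ, M = O.map (Complex.ofRealHom : ℝ →+* ℂ)

lemma IsRealOrthogonal.mul {M N : Matrix n n ℂ} (hM : IsRealOrthogonal M)
    (hN : IsRealOrthogonal N) : IsRealOrthogonal (M * N) := by
  obtain ⟨O, hO, rfl⟩ := hM
  obtain ⟨O', hO', rfl⟩ := hN
  exact ⟨O * O', mul_mem hO hO', (Matrix.map_mul).symm⟩

lemma IsRealOrthogonal.transpose {M : Matrix n n ℂ} (hM : IsRealOrthogonal M) :
    IsRealOrthogonal Mᵀ := by
  obtain ⟨O, hO, rfl⟩ := hM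
  exact ⟨Oᵀ, transpose_mem_unitaryGroup_iff.mpr hO, rfl⟩

lemma IsRealOrthogonal.mul_transpose {M : Matrix n n ℂ} (hM : IsRealOrthogonal M) :
    M * Mᵀ = 1 := by
  obtain ⟨O, hO, rfl⟩ := hM
  have := mem_unitaryGroup_iff.mp hO
  rw [star_eq_conjTranspose, conjTranspose_eq_transpose_of_trivial] at this
  rw [← transpose_map, ← Matrix.map_mul, this, Matrix.map_one _ (map_zero _) (map_one _)]

lemma IsRealOrthogonal.transpose_mul {M : Matrix n n ℂ} (hM : IsRealOrthogonal M) :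
    Mᵀ * M = 1 := by
  have := hM.transpose.mul_transpose
  rwa [transpose_transpose] at this

lemma IsRealOrthogonal.mem_unitaryGroup {M : Matrix n n ℂ} (hM : IsRealOrthogonal M) :
    M ∈ Matrix.unitaryGroup n ℂ := by
  have h := hM.mul_transpose
  obtain ⟨O, hO, rfl⟩ := hM
  rw [mem_unitaryGroup_iff]
  refine h ▸ congrArg (O.map _ * ·) ?_
  ext i j
  simp [star_apply]

/-- A unitary matrix with real entries is real orthogonal. -/
lemma IsRealOrthogonal.of_map_star {M : Matrix n n ℂ} (hM : M ∈ Matrix.unitaryGroup n ℂ)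
    (h : ∀ i j, star (M i j) = M i j) : IsRealOrthogonal M := by
  have hmap : M = (M.map Complex.re).map (Complex.ofRealHom : ℝ →+* ℂ) := by
    ext i j
    exact (Complex.conj_eq_iff_re.mp (h i j)).symm
  refine ⟨M.map Complex.re, ?_, hmap⟩
  rw [mem_unitaryGroup_iff, star_eq_conjTranspose, conjTranspose_eq_transpose_of_trivial]
  have h1 := unitary_mul_conjTranspose hM
  have h2 : Mᴴ = (M.map Complex.re)ᵀ.map (Complex.ofRealHom : ℝ →+* ℂ) := by
    ext i j
    rw [conjTranspose_apply, h]
    exact (Complex.conj_eq_iff_re.mp (h j i)).symm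
  rw [h2] at h1
  conv_lhs at h1 => rw [hmap]
  rw [← Matrix.map_mul] at h1
  ext i j
  have h3 := congrFun (congrFun h1 i) j
  rw [Matrix.map_apply] at h3
  apply Complex.ofReal_injective
  rw [show ((((M.map Complex.re) * (M.map Complex.re)ᵀ) i j : ℝ) : ℂ) = _ from h3, one_apply,
    one_apply]
  split_ifs <;> simp

/-- The `O₁ D O₂` decomposition of a unitary: `O₂` diagonalizes the commuting real and imaginary
parts of the symmetric unitary `Uᵀ U`, and `D` is a square root of the diagonal form. -/
lemma exists_realOrthogonal_mul_diagonal_mul {U : Matrix n n ℂ}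
    (hU : U ∈ Matrix.unitaryGroup n ℂ) :
    ∃ O₁ O₂ : Matrix n n ℂ, IsRealOrthogonal O₁ ∧ IsRealOrthogonal O₂ ∧
      ∃ d : n → ℂ, (∀ j, ‖d j‖ = 1) ∧ U = O₁ * diagonal d * O₂ := by
  let S := Uᵀ * U
  have hS : S ∈ Matrix.unitaryGroup n ℂ := mul_mem (transpose_mem_unitaryGroup_iff.mpr hU) hU
  have hST : Sᵀ = S := by simp [S, transpose_mul]
  let f : Matrix n n ℝ →+* Matrix n n ℂ := (Complex.ofRealHom : ℝ →+* ℂ).mapMatrix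
  let X := S.map Complex.re
  let Y := S.map Complex.im
  have hXY : S = f X + Complex.I • f Y := by
    ext i j
    simp only [Matrix.add_apply, Matrix.smul_apply, smul_eq_mul, f, X, Y, RingHom.mapMatrix_apply,
      Matrix.map_apply, Complex.ofRealHom_eq_coe]
    rw [mul_comm, Complex.re_add_im]
  have hXT : Xᵀ = X := by rw [← transpose_map, hST]
  have hYT : Yᵀ = Y := by rw [← transpose_map, hST]
  have hstar : Sᴴ = f X - Complex.I • f Y := by
    rw [← hST]
    ext i j
    simp only [conjTranspose_apply, transpose_apply, Matrix.sub_apply, Matrix.smul_apply,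
      smul_eq_mul, f, X, Y, RingHom.mapMatrix_apply, Matrix.map_apply, Complex.ofRealHom_eq_coe,
      RCLike.star_def]
    apply Complex.ext <;> simp
  have hcomm : X * Y = Y * X := by
    have h := unitary_mul_conjTranspose hS
    rw [hstar] at h
    conv_lhs at h => rw [hXY]
    have h2 : f (X * X + Y * Y) + Complex.I • f (Y * X - X * Y) = 1 := by
      rw [← h]
      simp only [map_add, map_sub, map_mul, mul_sub, add_mul, smul_mul_assoc, mul_smul_comm,
        smul_sub, smul_smul, Complex.I_mul_I, smul_add, neg_smul, one_smul]
      abel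
    ext i j
    have h3 := congrArg Complex.im (congrFun (congrFun h2 i) j)
    simp only [Matrix.add_apply, Matrix.smul_apply, smul_eq_mul, f, RingHom.mapMatrix_apply,
      Matrix.map_apply, Complex.ofRealHom_eq_coe, Complex.add_im, Complex.ofReal_im,
      Complex.mul_im, Complex.I_re, Complex.I_im, Complex.ofReal_re, one_apply] at h3
    have h4 : ((if i = j then 1 else 0 : ℂ)).im = 0 := by split_ifs <;> simp
    rw [h4] at h3
    simp only [Matrix.sub_apply] at h3
    linarith
  obtain ⟨P, hP, α, β, hα, hβ⟩ := exists_unitary_joint_diagonalization (𝕜 := ℝ)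
    (A := X) (B := Y) (by rw [IsHermitian, conjTranspose_eq_transpose_of_trivial, hXT])
    (by rw [IsHermitian, conjTranspose_eq_transpose_of_trivial, hYT]) hcomm
  have hfP : IsRealOrthogonal (f P) := ⟨P, hP, rfl⟩
  have hfPu := hfP.mem_unitaryGroup
  let z : n → ℂ := fun j => α j + Complex.I * β j
  have hSz : S = f P * diagonal z * (f P)ᵀ := by
    have hfd : ∀ γ : n → ℝ, f (diagonal γ) = diagonal fun j => (γ j : ℂ) := fun γ => by
      simp [f, diagonal_map]
    have hz : diagonal z = f (diagonal α) + Complex.I • f (diagonal β) := by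
      rw [hfd, hfd, ← diagonal_smul, diagonal_add]
      rfl
    rw [hXY, hα, hβ, map_mul, map_mul, map_mul, map_mul, hz, mul_add, add_mul, mul_smul_comm,
      smul_mul_assoc]
    rfl
  have hz : ∀ j, ‖z j‖ = 1 := by
    refine norm_eq_one_of_diagonal_mem_unitaryGroup (𝕜 := ℂ) ?_
    have : diagonal z = (f P)ᵀ * S * f P := by
      rw [hSz, show (f P)ᵀ * (f P * diagonal z * (f P)ᵀ) * f P =
        ((f P)ᵀ * f P) * diagonal z * ((f P)ᵀ * f P) by simp only [mul_assoc],
        hfP.transpose_mul, one_mul, mul_one]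
    rw [this]
    exact mul_mem (mul_mem (transpose_mem_unitaryGroup_iff.mpr hfPu) hS) hfPu
  let d : n → ℂ := fun j => Complex.exp (Complex.I * ((z j).arg / 2))
  let d' : n → ℂ := fun j => Complex.exp (-(Complex.I * ((z j).arg / 2)))
  have hdd : ∀ j, d j * d j = z j := by
    intro j
    rw [← Complex.exp_add]
    conv_rhs => rw [← Complex.norm_mul_exp_arg_mul_I (z j), hz j, Complex.ofReal_one, one_mul]
    congr 1
    ring
  have hdd' : ∀ j, d' j * d j = 1 := fun j => by
    rw [← Complex.exp_add, neg_add_cancel, Complex.exp_zero]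
  have hd : ∀ j, ‖d j‖ = 1 := fun j => by
    rw [Complex.norm_exp]; simp
  have hd' : ∀ j, ‖d' j‖ = 1 := fun j => by
    rw [Complex.norm_exp]; simp
  let O := U * f P * diagonal d'
  have hO : O ∈ Matrix.unitaryGroup n ℂ :=
    mul_mem (mul_mem hU hfPu) (diagonal_mem_unitaryGroup hd')
  -- `O` is unitary and complex orthogonal, hence real
  have hOO : Oᵀ * O = 1 := by
    have : Oᵀ * O = diagonal d' * ((f P)ᵀ * S * f P) * diagonal d' := by
      simp only [O, transpose_mul, diagonal_transpose, S, mul_assoc]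
    rw [this, hSz, show (f P)ᵀ * (f P * diagonal z * (f P)ᵀ) * f P =
        ((f P)ᵀ * f P) * diagonal z * ((f P)ᵀ * f P) by simp only [mul_assoc],
        hfP.transpose_mul, one_mul, mul_one, diagonal_mul_diagonal, diagonal_mul_diagonal,
        ← diagonal_one]
    congr 1
    ext j
    rw [← hdd]
    linear_combination (d' j * d j + 1) * hdd' j
  have hOreal : IsRealOrthogonal O := by
    refine .of_map_star hO fun i j => ?_
    have h1 : Oᵀ = Oᴴ := by
      rw [← mul_one Oᵀ, ← unitary_mul_conjTranspose hO, ← mul_assoc, hOO, one_mul]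
    have h2 := congrFun (congrFun h1 j) i
    rw [transpose_apply, conjTranspose_apply] at h2
    exact h2.symm
  refine ⟨O, (f P)ᵀ, hOreal, hfP.transpose, d, hd, ?_⟩
  have : diagonal d' * diagonal d = 1 := by
    rw [diagonal_mul_diagonal, ← diagonal_one]
    exact congrArg _ (funext hdd')
  calc U = U * (f P * (f P)ᵀ) := by rw [hfP.mul_transpose, mul_one]
    _ = U * f P * (diagonal d' * diagonal d) * (f P)ᵀ := by
        rw [this]; simp only [mul_assoc, one_mul]
    _ = _ := by simp only [O, mul_assoc]

end RealOrthogonal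

/-! ### Two qubits in the magic basis -/

/-- Matrices of two-qubit operators, on the tensor product of two one-qubit spaces. -/
abbrev TwoQubit : Type := Matrix (Fin 2 × Fin 2) (Fin 2 × Fin 2) ℂ

/-- The magic basis, without the normalization `1 / √2`: as `2 × 2` matrices, the columns are
`1`, `i Z`, `i X` and `i Y`, whose real span is the quaternions. -/
def magicBasis : TwoQubit := of fun r c =>
  (![![!![1, 0; 0, 1], !![Complex.I, 0; 0, -Complex.I]],
    ![!![0, Complex.I; Complex.I, 0], !![0, 1; -1, 0]]] c.1 c.2 : Matrix (Fin 2) (Fin 2) ℂ) r.1 r.2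

/-- The operator whose matrix in the magic basis is `X`. -/
noncomputable def ofMagic (X : TwoQubit) : TwoQubit := (1 / 2 : ℂ) • (magicBasis * X * magicBasisᴴ)

lemma magicBasis_mul_conjTranspose : magicBasis * magicBasisᴴ = (2 : ℂ) • (1 : TwoQubit) := by
  ext ⟨i, j⟩ ⟨k, l⟩
  fin_cases i <;> fin_cases j <;> fin_cases k <;> fin_cases l <;>
    norm_num [magicBasis, mul_apply, Fintype.sum_prod_type, Fin.sum_univ_two, one_apply]

lemma magicBasis_conjTranspose_mul : magicBasisᴴ * magicBasis = (2 : ℂ) • (1 : TwoQubit) := by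
  ext ⟨i, j⟩ ⟨k, l⟩
  fin_cases i <;> fin_cases j <;> fin_cases k <;> fin_cases l <;>
    norm_num [magicBasis, mul_apply, Fintype.sum_prod_type, Fin.sum_univ_two, one_apply]

lemma ofMagic_mul (X Y : TwoQubit) : ofMagic (X * Y) = ofMagic X * ofMagic Y := by
  simp only [ofMagic, smul_mul_smul_comm]
  rw [show magicBasis * X * magicBasisᴴ * (magicBasis * Y * magicBasisᴴ) =
    magicBasis * X * (magicBasisᴴ * magicBasis) * (Y * magicBasisᴴ) by simp only [mul_assoc],
    magicBasis_conjTranspose_mul, mul_smul_comm, smul_mul_assoc, smul_smul, mul_one]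
  simp only [mul_assoc]
  norm_num

lemma ofMagic_one : ofMagic 1 = 1 := by
  rw [ofMagic, mul_one, magicBasis_mul_conjTranspose, smul_smul]
  norm_num

/-- The exchange of the two qubits. -/
def swapMatrix : TwoQubit := of fun r c => if r.1 = c.2 ∧ r.2 = c.1 then 1 else 0

/-- A tensor product of two special unitary matrices. -/
def IsLocal (L : TwoQubit) : Prop :=
  ∃ A ∈ Matrix.unitaryGroup (Fin 2) ℂ, ∃ B ∈ Matrix.unitaryGroup (Fin 2) ℂ,
    A.det = 1 ∧ B.det = 1 ∧ L = A ⊗ₖ B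

lemma IsLocal.one : IsLocal 1 :=
  ⟨1, one_mem _, 1, one_mem _, det_one, det_one, one_kronecker_one.symm⟩

lemma IsLocal.mul {L L' : TwoQubit} (h : IsLocal L) (h' : IsLocal L') : IsLocal (L * L') := by
  obtain ⟨A, hA, B, hB, dA, dB, rfl⟩ := h
  obtain ⟨A', hA', B', hB', dA', dB', rfl⟩ := h'
  exact ⟨A * A', mul_mem hA hA', B * B', mul_mem hB hB', by rw [det_mul, dA, dA', one_mul],
    by rw [det_mul, dB, dB', one_mul], (mul_kronecker_mul ..).symm⟩

lemma IsLocal.det {L : TwoQubit} (h : IsLocal L) : L.det = 1 := by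
  obtain ⟨A, hA, B, hB, dA, dB, rfl⟩ := h
  simp [det_kronecker, dA, dB]

lemma swapMatrix_mul_self : swapMatrix * swapMatrix = 1 := by
  ext ⟨i, j⟩ ⟨k, l⟩
  fin_cases i <;> fin_cases j <;> fin_cases k <;> fin_cases l <;>
    simp [swapMatrix, mul_apply, Fintype.sum_prod_type, Fin.sum_univ_two, one_apply]

lemma swapMatrix_mul_kronecker (A B : Matrix (Fin 2) (Fin 2) ℂ) :
    swapMatrix * (A ⊗ₖ B) = (B ⊗ₖ A) * swapMatrix := by
  ext ⟨i, j⟩ ⟨k, l⟩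
  fin_cases i <;> fin_cases j <;> fin_cases k <;> fin_cases l <;>
    simp [swapMatrix, mul_apply, Fintype.sum_prod_type, Fin.sum_univ_two, mul_comm (A _ _)]

lemma IsLocal.swap_mul {L : TwoQubit} (h : IsLocal L) :
    ∃ L', IsLocal L' ∧ swapMatrix * L = L' * swapMatrix := by
  obtain ⟨A, hA, B, hB, dA, dB, rfl⟩ := h
  exact ⟨_, ⟨B, hB, A, hA, dB, dA, rfl⟩, swapMatrix_mul_kronecker A B⟩

/-- The reflection in the hyperplane orthogonal to the unit quaternion `v` is `x ↦ - v x̄ v`, and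
`x̄` is `-(iY) xᵀ (iY)`, where `iY` is the quaternion of the last column of the magic basis. -/
lemma ofMagic_reflection (v : Fin 2 × Fin 2 → ℝ) (hv : ∑ i, v i ^ 2 = 1) :
    ∃ L, IsLocal L ∧ ofMagic ((1 - (2 : ℝ) • vecMulVec v v).map (Complex.ofRealHom : ℝ →+* ℂ)) =
      L * swapMatrix := by
  simp only [Fintype.sum_prod_type, Fin.sum_univ_two] at hv
  set a := v (0, 0) with ha
  set b := v (0, 1) with hb
  set c := v (1, 0) with hc
  set d := v (1, 1) with hd
  have hvC : (a : ℂ) ^ 2 + (b : ℂ) ^ 2 + ((c : ℂ) ^ 2 + (d : ℂ) ^ 2) = 1 := by exact_mod_cast hv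
  let V : Matrix (Fin 2) (Fin 2) ℂ :=
    !![a + Complex.I * b, d + Complex.I * c; -d + Complex.I * c, a - Complex.I * b]
  let J : Matrix (Fin 2) (Fin 2) ℂ := !![0, 1; -1, 0]
  have hV : V ∈ Matrix.unitaryGroup (Fin 2) ℂ := by
    rw [mem_unitaryGroup_iff, star_eq_conjTranspose]
    ext i j
    fin_cases i <;> fin_cases j <;>
      simp [V, mul_apply, Fin.sum_univ_two] <;>
      first
      | ring1
      | linear_combination hvC - ((b : ℂ) ^ 2 + (c : ℂ) ^ 2) * Complex.I_sq
  have hJ : J ∈ Matrix.unitaryGroup (Fin 2) ℂ := by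
    rw [mem_unitaryGroup_iff, star_eq_conjTranspose]
    ext i j
    fin_cases i <;> fin_cases j <;> simp [J, mul_apply, Fin.sum_univ_two]
  have dV : V.det = 1 := by
    rw [det_fin_two_of]
    linear_combination hvC - ((b : ℂ) ^ 2 + (c : ℂ) ^ 2) * Complex.I_sq
  have dJ : J.det = 1 := by simp [J, det_fin_two_of]
  refine ⟨(V * J) ⊗ₖ (J * V)ᵀ, ⟨_, mul_mem hV hJ, _,
    transpose_mem_unitaryGroup_iff.mpr (mul_mem hJ hV), by rw [det_mul, dV, dJ, one_mul],
    by rw [det_transpose, det_mul, dV, dJ, one_mul], rfl⟩, ?_⟩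
  have hI := Complex.I_sq
  have hr : ∀ r s : Fin 2 × Fin 2, ((1 - (2 : ℝ) • vecMulVec v v).map
      (Complex.ofRealHom : ℝ →+* ℂ)) r s = (if r = s then 1 else 0) - 2 * ((v r : ℂ) * v s) := by
    intro r s
    simp only [Matrix.map_apply, Matrix.sub_apply, Matrix.smul_apply, one_apply, vecMulVec_apply,
      Complex.ofRealHom_eq_coe, smul_eq_mul]
    split_ifs <;> push_cast <;> ring
  ext ⟨i, j⟩ ⟨k, l⟩
  simp only [ofMagic, Matrix.smul_apply, smul_eq_mul, mul_apply, hr, Fintype.sum_prod_type,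
    Fin.sum_univ_two, ← ha, ← hb, ← hc, ← hd]
  fin_cases i <;> fin_cases j <;> fin_cases k <;> fin_cases l <;>
    simp [magicBasis, swapMatrix, V, J] <;>
    first
    | ring1
    | (ring_nf; simp only [Complex.I_sq]; first
        | ring1
        | linear_combination hvC
        | linear_combination -hvC)

/-- The reflection that fixes the first three vectors of the magic basis is the exchange of the
two qubits, the fourth vector being the antisymmetric one. -/
lemma ofMagic_diagonal_swap :
    ofMagic (diagonal fun c => if c = (1, 1) then -1 else 1) = swapMatrix := by
  ext ⟨i, j⟩ ⟨k, l⟩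
  fin_cases i <;> fin_cases j <;> fin_cases k <;> fin_cases l <;>
    norm_num [ofMagic, magicBasis, swapMatrix, mul_apply, Fintype.sum_prod_type, Fin.sum_univ_two,
      diagonal_apply]

/-- The surjection of `SU(2) × SU(2)` onto `SO(4)`, in the form needed here: real orthogonal
matrices in the magic basis are local up to an exchange of the qubits. -/
lemma IsRealOrthogonal.ofMagic {O : TwoQubit} (hO : IsRealOrthogonal O) :
    ∃ L, IsLocal L ∧ (SIABLE.ofMagic O = L ∨ SIABLE.ofMagic O = L * swapMatrix) := by
  obtain ⟨O, hO, rfl⟩ := hO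
  refine orthogonal_induction (p := fun O : Matrix (Fin 2 × Fin 2) (Fin 2 × Fin 2) ℝ =>
    ∃ L, IsLocal L ∧ (SIABLE.ofMagic (O.map (Complex.ofRealHom : ℝ →+* ℂ)) = L ∨
      SIABLE.ofMagic (O.map (Complex.ofRealHom : ℝ →+* ℂ)) = L * swapMatrix)) ?_ ?_ hO
  · refine ⟨1, .one, .inl ?_⟩
    rw [Matrix.map_one _ (map_zero _) (map_one _), ofMagic_one]
  · rintro v hv O ⟨L, hL, h⟩
    obtain ⟨L', hL', hv'⟩ := ofMagic_reflection v hv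
    obtain ⟨L'', hL'', hs⟩ := hL.swap_mul
    refine ⟨L' * L'', hL'.mul hL'', ?_⟩
    rw [Matrix.map_mul, ofMagic_mul, hv']
    rcases h with h | h
    · right
      rw [h, mul_assoc, hs, mul_assoc]
    · left
      rw [h, mul_assoc, ← mul_assoc swapMatrix, hs, mul_assoc L'', swapMatrix_mul_self, mul_one]

/-- The bilinear form `σ = - Y ⊗ Y`, for which the magic basis is orthonormal up to its
normalization. -/
def flipForm : TwoQubit := of fun r c =>
  if r.1 ≠ c.1 ∧ r.2 ≠ c.2 then (if r.1 = r.2 then 1 else -1) else 0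

lemma transpose_magicBasis_flipForm : magicBasisᵀ * flipForm * magicBasis = (2 : ℂ) • 1 := by
  ext ⟨i, j⟩ ⟨k, l⟩
  fin_cases i <;> fin_cases j <;> fin_cases k <;> fin_cases l <;>
    norm_num [magicBasis, flipForm, mul_apply, Fintype.sum_prod_type, Fin.sum_univ_two, one_apply]

lemma conjTranspose_magicBasis_flipForm : magicBasisᴴ * flipForm * magicBasisᴴᵀ = (2 : ℂ) • 1 := by
  ext ⟨i, j⟩ ⟨k, l⟩
  fin_cases i <;> fin_cases j <;> fin_cases k <;> fin_cases l <;>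
    norm_num [magicBasis, flipForm, mul_apply, Fintype.sum_prod_type, Fin.sum_univ_two, one_apply]

lemma det_ofMagic (X : TwoQubit) : (ofMagic X).det = X.det := by
  have h := congrArg Matrix.det magicBasis_mul_conjTranspose
  simp only [ofMagic, det_smul, det_mul, det_one] at h ⊢
  norm_num at h ⊢
  linear_combination (1 / 16 : ℂ) * X.det * h

/-- In terms of the `O₁ D O₂` decomposition of `X` the right-hand side is the trace of `D ^ 2`. -/
lemma trace_flipForm_ofMagic (X : TwoQubit) :
    trace ((ofMagic X)ᵀ * flipForm * ofMagic X * flipForm) = trace (Xᵀ * X) := by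
  have h : (ofMagic X)ᵀ * flipForm * ofMagic X * flipForm = magicBasisᴴᵀ *
      ((1 / 4 : ℂ) •
        (Xᵀ * (magicBasisᵀ * flipForm * magicBasis) * X * (magicBasisᴴ * flipForm))) := by
    simp only [ofMagic, transpose_smul, transpose_mul, smul_mul_assoc, mul_smul_comm, smul_smul]
    norm_num [mul_assoc]
  rw [h, trace_mul_comm, transpose_magicBasis_flipForm, smul_mul_assoc, mul_assoc _ _ magicBasisᴴᵀ,
    conjTranspose_magicBasis_flipForm]
  simp only [mul_smul_comm, smul_mul_assoc, mul_one, smul_smul, trace_smul, smul_eq_mul]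
  ring

/-- If four points of the unit circle have product `1` and a real sum, the first one is inverse to
one of the others: then the first and third elementary symmetric functions agree, and
`(ab - 1) (ac - 1) (ad - 1)` is `a` times their difference. -/
lemma exists_inverse_pair {a b c d : ℂ} (ha : ‖a‖ = 1) (hb : ‖b‖ = 1) (hc : ‖c‖ = 1)
    (hd : ‖d‖ = 1) (hprod : a * b * c * d = 1) (hsum : (a + b + c + d).im = 0) :
    a * b = 1 ∨ a * c = 1 ∨ a * d = 1 := by
  have hconj : ∀ {z : ℂ}, ‖z‖ = 1 → z * (starRingEnd ℂ) z = 1 := fun h => by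
    rw [Complex.mul_conj', h]; simp
  have h := Complex.conj_eq_iff_im.mpr hsum
  simp only [map_add] at h
  have ea : (starRingEnd ℂ) a = b * c * d := by
    linear_combination (-(starRingEnd ℂ) a) * hprod + b * c * d * hconj ha
  have eb : (starRingEnd ℂ) b = a * c * d := by
    linear_combination (-(starRingEnd ℂ) b) * hprod + a * c * d * hconj hb
  have ec : (starRingEnd ℂ) c = a * b * d := by
    linear_combination (-(starRingEnd ℂ) c) * hprod + a * b * d * hconj hc
  have ed : (starRingEnd ℂ) d = a * b * c := by
    linear_combination (-(starRingEnd ℂ) d) * hprod + a * b * c * hconj hd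
  rw [ea, eb, ec, ed] at h
  have key : (a * b - 1) * ((a * c - 1) * (a * d - 1)) = 0 := by
    linear_combination (a ^ 2 + 1) * hprod - a * h
  rcases mul_eq_zero.mp key with h | h
  · exact .inl (sub_eq_zero.mp h)
  rcases mul_eq_zero.mp h with h | h
  · exact .inr (.inl (sub_eq_zero.mp h))
  · exact .inr (.inr (sub_eq_zero.mp h))

lemma isRealOrthogonal_perm {n : Type*} [Fintype n] [DecidableEq n] (π : Equiv.Perm n) :
    IsRealOrthogonal ((1 : Matrix n n ℂ).submatrix π id) := by
  refine ⟨(1 : Matrix n n ℝ).submatrix π id, ?_, ?_⟩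
  · rw [mem_unitaryGroup_iff, star_eq_conjTranspose, conjTranspose_submatrix, conjTranspose_one]
    ext i j
    simp [mul_apply, one_apply, eq_comm]
  · rw [← submatrix_map, Matrix.map_one _ (map_zero _) (map_one _)]

lemma isRealOrthogonal_swap : IsRealOrthogonal
    (diagonal fun c : Fin 2 × Fin 2 => if c = (1, 1) then (-1 : ℂ) else 1) := by
  refine .of_map_star (diagonal_mem_unitaryGroup fun j => by split_ifs <;> simp) fun i j => ?_
  rw [diagonal_apply]
  split_ifs <;> simp

/-- A real orthogonal matrix in the magic basis becomes local after a possible sign change of the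
last basis vector. -/
lemma IsRealOrthogonal.exists_sign {O : TwoQubit} (hO : IsRealOrthogonal O) :
    ∃ s : Fin 2 × Fin 2 → ℂ, (∀ c, s c * s c = 1) ∧ IsRealOrthogonal (O * diagonal s) ∧
      IsLocal (SIABLE.ofMagic (O * diagonal s)) := by
  obtain ⟨L, hL, h | h⟩ := hO.ofMagic
  · refine ⟨fun _ => 1, fun c => one_mul 1, ?_⟩
    rw [diagonal_one, mul_one, h]
    exact ⟨hO, hL⟩
  · refine ⟨fun c => if c = (1, 1) then -1 else 1, fun c => by
      by_cases h : c = (1, 1) <;> simp [h],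
      hO.mul isRealOrthogonal_swap, ?_⟩
    rw [ofMagic_mul, h, ofMagic_diagonal_swap, mul_assoc, swapMatrix_mul_self, mul_one]
    exact hL

lemma IsLocal.transpose_ofMagic {O : TwoQubit} (hO : IsRealOrthogonal O)
    (h : IsLocal (ofMagic O)) : IsLocal (ofMagic Oᵀ) := by
  obtain ⟨A, hA, B, hB, dA, dB, hL⟩ := h
  have h1 : ofMagic O * ofMagic Oᵀ = 1 := by rw [← ofMagic_mul, hO.mul_transpose, ofMagic_one]
  have h2 : (Aᴴ ⊗ₖ Bᴴ) * ofMagic O = 1 := by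
    rw [hL, ← mul_kronecker_mul, unitary_conjTranspose_mul hA, unitary_conjTranspose_mul hB,
      one_kronecker_one]
  refine ⟨Aᴴ, Unitary.star_mem hA, Bᴴ, Unitary.star_mem hB, by rw [det_conjTranspose, dA, star_one],
    by rw [det_conjTranspose, dB, star_one], ?_⟩
  rw [← mul_one (Aᴴ ⊗ₖ Bᴴ), ← h1, ← mul_assoc, h2, one_mul]

/-- This sign change of two vectors of the magic basis is `i Z ⊗ i Z`. -/
lemma isLocal_ofMagic_sign :
    IsLocal (ofMagic (diagonal fun c => if c.1 = 0 then -1 else 1)) := by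
  let Z : Matrix (Fin 2) (Fin 2) ℂ := !![Complex.I, 0; 0, -Complex.I]
  have hZ : Z ∈ Matrix.unitaryGroup (Fin 2) ℂ := by
    rw [mem_unitaryGroup_iff, star_eq_conjTranspose]
    ext i j
    fin_cases i <;> fin_cases j <;> simp [Z, mul_apply, Fin.sum_univ_two]
  have dZ : Z.det = 1 := by simp [Z, det_fin_two_of]
  refine ⟨Z, hZ, Z, hZ, dZ, dZ, ?_⟩
  ext ⟨i, j⟩ ⟨k, l⟩
  fin_cases i <;> fin_cases j <;> fin_cases k <;> fin_cases l <;>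
    norm_num [ofMagic, magicBasis, Z, mul_apply, Fintype.sum_prod_type, Fin.sum_univ_two,
      diagonal_apply]

/-- A special unitary two-qubit operator for which the trace of `Uᵀ σ U σ` is real is, up to local
factors, diagonal in the magic basis with the entries in inverse pairs. -/
lemma exists_local_mul_ofMagic_diagonal_mul_local {U : TwoQubit}
    (hU : U ∈ Matrix.unitaryGroup (Fin 2 × Fin 2) ℂ) (hdet : U.det = 1)
    (htr : (trace (Uᵀ * flipForm * U * flipForm)).im = 0) :
    ∃ L L' : TwoQubit, IsLocal L ∧ IsLocal L' ∧ ∃ x y : ℂ, ‖x‖ = 1 ∧ ‖y‖ = 1 ∧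
      U = L * ofMagic (diagonal fun c => ![![x, y], ![y⁻¹, x⁻¹]] c.1 c.2) * L' := by
  let X : TwoQubit := (1 / 2 : ℂ) • (magicBasisᴴ * U * magicBasis)
  have hXU : ofMagic X = U := by
    simp only [ofMagic, X, mul_smul_comm, smul_mul_assoc, smul_smul]
    rw [show magicBasis * (magicBasisᴴ * U * magicBasis) * magicBasisᴴ =
      (magicBasis * magicBasisᴴ) * U * (magicBasis * magicBasisᴴ) by simp only [mul_assoc],
      magicBasis_mul_conjTranspose]
    simp only [mul_smul_comm, smul_mul_assoc, smul_smul, mul_one, one_mul]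
    norm_num
  have hX : X ∈ Matrix.unitaryGroup (Fin 2 × Fin 2) ℂ := by
    rw [mem_unitaryGroup_iff, star_eq_conjTranspose]
    simp only [X, conjTranspose_smul, conjTranspose_mul, conjTranspose_conjTranspose,
      smul_mul_smul_comm]
    rw [show magicBasisᴴ * U * magicBasis * (magicBasisᴴ * (Uᴴ * magicBasis)) =
      magicBasisᴴ * (U * (magicBasis * magicBasisᴴ) * Uᴴ) * magicBasis by simp only [mul_assoc],
      magicBasis_mul_conjTranspose, mul_smul_comm, mul_one, smul_mul_assoc,
      unitary_mul_conjTranspose hU, mul_smul_comm, mul_one, smul_mul_assoc,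
      magicBasis_conjTranspose_mul, smul_smul, smul_smul]
    norm_num
  have hdetX : X.det = 1 := by rw [← hdet, ← hXU, det_ofMagic]
  obtain ⟨O₁, O₂, hO₁, hO₂, d, hd, hXd⟩ := exists_realOrthogonal_mul_diagonal_mul hX
  have htrd : trace (Uᵀ * flipForm * U * flipForm) = ∑ c, d c ^ 2 := by
    rw [← hXU, trace_flipForm_ofMagic, hXd]
    simp only [transpose_mul, diagonal_transpose]
    rw [show O₂ᵀ * (diagonal d * O₁ᵀ) * (O₁ * diagonal d * O₂) =
      O₂ᵀ * (diagonal d * (O₁ᵀ * O₁) * diagonal d * O₂) by simp only [mul_assoc],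
      hO₁.transpose_mul, trace_mul_comm, mul_assoc, hO₂.mul_transpose, mul_one, mul_one,
      diagonal_mul_diagonal, trace_diagonal]
    exact Finset.sum_congr rfl fun c _ => (sq (d c)).symm
  have hdetO : ∀ O : TwoQubit, IsRealOrthogonal O → O.det ^ 2 = 1 := fun O hO => by
    have := congrArg Matrix.det hO.mul_transpose
    rwa [det_mul, det_transpose, det_one, ← sq] at this
  have hprod : (∏ c, d c) ^ 2 = 1 := by
    have h := congrArg (· ^ 2) hdetX
    simp only [hXd, det_mul, det_diagonal, mul_pow, hdetO O₁ hO₁, hdetO O₂ hO₂] at h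
    simpa using h
  -- an entry whose square is inverse to that of the first one is moved to the last place
  obtain ⟨j, hj0, hj⟩ : ∃ j, j ≠ (0, 0) ∧ d (0, 0) ^ 2 * d j ^ 2 = 1 := by
    rw [htrd, Fintype.sum_prod_type, Fin.sum_univ_two, Fin.sum_univ_two, Fin.sum_univ_two,
      ← add_assoc] at htr
    rw [Fintype.prod_prod_type, Fin.prod_univ_two, Fin.prod_univ_two, Fin.prod_univ_two] at hprod
    have hd2 : ∀ c, ‖d c ^ 2‖ = 1 := fun c => by rw [norm_pow, hd, one_pow]
    rcases exists_inverse_pair (hd2 (0, 0)) (hd2 (0, 1)) (hd2 (1, 0)) (hd2 (1, 1))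
      (by rw [← hprod]; ring) htr with h | h | h
    · exact ⟨_, by decide, h⟩
    · exact ⟨_, by decide, h⟩
    · exact ⟨_, by decide, h⟩
  let π : Equiv.Perm (Fin 2 × Fin 2) := Equiv.swap j (1, 1)
  let R : TwoQubit := (1 : TwoQubit).submatrix π id
  have hR : IsRealOrthogonal R := isRealOrthogonal_perm π
  have hRd : diagonal d = Rᵀ * diagonal (d ∘ π) * R := by
    have : R * diagonal d = diagonal (d ∘ π) * R := by
      ext r c
      simp only [R, mul_diagonal, diagonal_mul, submatrix_apply, one_apply, id,
        Function.comp_apply]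
      split_ifs with h <;> simp [h]
    rw [mul_assoc, ← this, ← mul_assoc, hR.transpose_mul, one_mul]
  obtain ⟨s, hs, -, hsL⟩ := (hO₁.mul hR.transpose).exists_sign
  obtain ⟨t, ht, htO, htL⟩ := (hR.mul hO₂).transpose.exists_sign
  have htL' := htL.transpose_ofMagic htO
  rw [transpose_mul, transpose_transpose, diagonal_transpose] at htL'
  have hnorm : ∀ {z : ℂ}, z * z = 1 → ‖z‖ = 1 := fun h => by
    have := congrArg norm h
    rw [norm_mul, norm_one] at this
    nlinarith [norm_nonneg ‹ℂ›]
  let e : Fin 2 × Fin 2 → ℂ := fun c => s c * d (π c) * t c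
  have he : ∀ c, ‖e c‖ = 1 := fun c => by
    simp only [e, norm_mul, hnorm (hs c), hnorm (ht c), hd, one_mul]
  have hUe : U = ofMagic (O₁ * Rᵀ * diagonal s) * ofMagic (diagonal e) *
      ofMagic (diagonal t * (R * O₂)) := by
    have hse : diagonal s * diagonal e * diagonal t = diagonal (d ∘ π) := by
      rw [diagonal_mul_diagonal, diagonal_mul_diagonal]
      congr 1
      ext c
      simp only [e, Function.comp_apply]
      linear_combination d (π c) * (t c * t c) * hs c + d (π c) * ht c
    rw [← hXU, hXd, hRd, ← ofMagic_mul, ← ofMagic_mul, ← hse]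
    simp only [mul_assoc]
  have hprod' : (e (0, 0) * e (1, 1)) * (e (0, 1) * e (1, 0)) = 1 := by
    have h := congrArg Matrix.det hUe
    rw [det_mul, det_mul, hsL.det, htL'.det, det_ofMagic, hdet, det_diagonal,
      Fintype.prod_prod_type, Fin.prod_univ_two, Fin.prod_univ_two, Fin.prod_univ_two] at h
    linear_combination -h
  have hpair : (e (0, 0) * e (1, 1)) ^ 2 = 1 := by
    have h0 : π (0, 0) = (0, 0) := Equiv.swap_apply_of_ne_of_ne hj0.symm (by decide)
    have h1 : π (1, 1) = j := Equiv.swap_apply_right _ _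
    simp only [e, h0, h1]
    calc _ = (s (0, 0) * s (0, 0)) * (s (1, 1) * s (1, 1)) * (t (0, 0) * t (0, 0)) *
          (t (1, 1) * t (1, 1)) * (d (0, 0) ^ 2 * d j ^ 2) := by ring
      _ = 1 := by rw [hs, hs, ht, ht, hj]; norm_num
  rcases mul_self_eq_one_iff.mp ((sq _).symm.trans hpair) with h | h
  · refine ⟨_, _, hsL, htL', e (0, 0), e (0, 1), he _, he _, ?_⟩
    have h' : e (0, 1) * e (1, 0) = 1 := by rw [h, one_mul] at hprod'; exact hprod'
    have hev : e = fun c => ![![e (0, 0), e (0, 1)], ![(e (0, 1))⁻¹, (e (0, 0))⁻¹]] c.1 c.2 := by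
      ext ⟨i, k⟩
      fin_cases i <;> fin_cases k
      · rfl
      · rfl
      · exact eq_inv_of_mul_eq_one_right h'
      · exact eq_inv_of_mul_eq_one_right h
    rw [← hev, hUe]
  · have h' : e (0, 1) * e (1, 0) = -1 := by
      rw [h] at hprod'
      linear_combination -hprod'
    refine ⟨_, _, hsL.mul isLocal_ofMagic_sign, htL', -e (0, 0), -e (0, 1),
      by rw [norm_neg, he], by rw [norm_neg, he], ?_⟩
    have hev : diagonal e = diagonal (fun c : Fin 2 × Fin 2 => if c.1 = 0 then -1 else 1) *
        diagonal (fun c => ![![-e (0, 0), -e (0, 1)],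
          ![(-e (0, 1))⁻¹, (-e (0, 0))⁻¹]] c.1 c.2) := by
      rw [diagonal_mul_diagonal]
      congr 1
      ext ⟨i, k⟩
      fin_cases i <;> fin_cases k
      · simp
      · simp
      · simpa using eq_inv_of_mul_eq_one_right (a := -e (0, 1)) (b := e (1, 0))
          (by linear_combination -h')
      · simpa using eq_inv_of_mul_eq_one_right (a := -e (0, 0)) (b := e (1, 1))
          (by linear_combination -h)
    rw [hUe, hev, ofMagic_mul (diagonal _) (diagonal _)]
    simp only [mul_assoc]

/-! ### Circuits for two-qubit unitaries -/

/-- The C-NOT with the first qubit as control, on the tensor product. -/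
def cnotMatrix : TwoQubit := of fun r c => if r.1 = c.1 ∧ r.2 = c.2 + c.1 then 1 else 0

lemma cnotMatrix_mul_self : cnotMatrix * cnotMatrix = 1 := by
  ext ⟨i, j⟩ ⟨k, l⟩
  fin_cases i <;> fin_cases j <;> fin_cases k <;> fin_cases l <;>
    simp [cnotMatrix, mul_apply, Fintype.sum_prod_type, Fin.sum_univ_two, one_apply]

lemma cnotMatrix_conjTranspose : cnotMatrixᴴ = cnotMatrix := by
  ext ⟨i, j⟩ ⟨k, l⟩
  fin_cases i <;> fin_cases j <;> fin_cases k <;> fin_cases l <;> simp [cnotMatrix]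

lemma cnotMatrix_mem_unitaryGroup : cnotMatrix ∈ Matrix.unitaryGroup (Fin 2 × Fin 2) ℂ := by
  rw [mem_unitaryGroup_iff, star_eq_conjTranspose, cnotMatrix_conjTranspose, cnotMatrix_mul_self]

/-- `U` is implemented by single-qubit gates and two C-NOTs. -/
def IsTwoCnot (U : TwoQubit) : Prop :=
  ∃ A₁ ∈ Matrix.unitaryGroup (Fin 2) ℂ, ∃ B₁ ∈ Matrix.unitaryGroup (Fin 2) ℂ,
  ∃ A₂ ∈ Matrix.unitaryGroup (Fin 2) ℂ, ∃ B₂ ∈ Matrix.unitaryGroup (Fin 2) ℂ,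
  ∃ A₃ ∈ Matrix.unitaryGroup (Fin 2) ℂ, ∃ B₃ ∈ Matrix.unitaryGroup (Fin 2) ℂ,
    U = (A₁ ⊗ₖ B₁) * cnotMatrix * (A₂ ⊗ₖ B₂) * cnotMatrix * (A₃ ⊗ₖ B₃)

lemma IsTwoCnot.smul {U : TwoQubit} (h : IsTwoCnot U) {κ : ℂ} (hκ : ‖κ‖ = 1) :
    IsTwoCnot (κ • U) := by
  obtain ⟨A₁, hA₁, B₁, hB₁, A₂, hA₂, B₂, hB₂, A₃, hA₃, B₃, hB₃, rfl⟩ := h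
  refine ⟨κ • A₁, ?_, B₁, hB₁, A₂, hA₂, B₂, hB₂, A₃, hA₃, B₃, hB₃, ?_⟩
  · have hκ' : κ * star κ = 1 := by
      rw [RCLike.star_def, Complex.mul_conj', hκ]; simp
    rw [mem_unitaryGroup_iff, star_smul, smul_mul_smul_comm, mem_unitaryGroup_iff.mp hA₁, hκ',
      one_smul]
  · simp only [smul_kronecker, smul_mul_assoc]

/-- With `x = exp (i (s + t))` and `y = exp (i (t - s))` the left-hand side is
`exp (i (s X ⊗ X + t Z ⊗ Z))`, and C-NOT conjugates `X ⊗ X` to `X ⊗ 1` and `Z ⊗ Z` to `1 ⊗ Z`. -/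
lemma exists_ofMagic_diagonal_eq_cnot {x y : ℂ} (hx : ‖x‖ = 1) (hy : ‖y‖ = 1) :
    ∃ P ∈ Matrix.unitaryGroup (Fin 2) ℂ, ∃ Q ∈ Matrix.unitaryGroup (Fin 2) ℂ,
      ofMagic (diagonal fun c => ![![x, y], ![y⁻¹, x⁻¹]] c.1 c.2) =
        cnotMatrix * (P ⊗ₖ Q) * cnotMatrix := by
  have hexp : ∀ {z : ℂ}, ‖z‖ = 1 → ∃ a : ℝ, z = Complex.exp (Complex.I * a) := fun {z} hz =>
    ⟨z.arg, by
      conv_lhs => rw [← Complex.norm_mul_exp_arg_mul_I z, hz, Complex.ofReal_one, one_mul]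
      rw [mul_comm]⟩
  obtain ⟨a, rfl⟩ := hexp hx
  obtain ⟨b, rfl⟩ := hexp hy
  obtain ⟨p, q, hp, hq, hp', hq', hxpq, hypq⟩ : ∃ p q : ℂ, p ≠ 0 ∧ q ≠ 0 ∧ star p = p⁻¹ ∧
      star q = q⁻¹ ∧ Complex.exp (Complex.I * a) = p * q ∧
      Complex.exp (Complex.I * b) = q * p⁻¹ := by
    refine ⟨Complex.exp (Complex.I * ((a - b) / 2 : ℝ)),
      Complex.exp (Complex.I * ((a + b) / 2 : ℝ)),
      Complex.exp_ne_zero _, Complex.exp_ne_zero _, ?_, ?_, ?_, ?_⟩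
    · rw [RCLike.star_def, ← Complex.exp_conj, ← Complex.exp_neg, map_mul, Complex.conj_I,
        Complex.conj_ofReal, neg_mul]
    · rw [RCLike.star_def, ← Complex.exp_conj, ← Complex.exp_neg, map_mul, Complex.conj_I,
        Complex.conj_ofReal, neg_mul]
    · rw [← Complex.exp_add]; push_cast; congr 1; ring
    · rw [← Complex.exp_neg, ← Complex.exp_add]; push_cast; congr 1; ring
  rw [hxpq, hypq]
  refine ⟨!![(p + p⁻¹) / 2, (p - p⁻¹) / 2; (p - p⁻¹) / 2, (p + p⁻¹) / 2], ?_,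
    !![q, 0; 0, q⁻¹], ?_, ?_⟩
  · rw [mem_unitaryGroup_iff, star_eq_conjTranspose]
    rw [RCLike.star_def] at hp'
    ext i j
    fin_cases i <;> fin_cases j <;>
      simp [mul_apply, Fin.sum_univ_two, hp', Complex.conj_ofNat] <;> field_simp <;> ring
  · rw [mem_unitaryGroup_iff, star_eq_conjTranspose]
    rw [RCLike.star_def] at hq'
    ext i j
    fin_cases i <;> fin_cases j <;> simp [mul_apply, Fin.sum_univ_two, hq', hq]
  · ext ⟨i, j⟩ ⟨k, l⟩
    simp only [ofMagic, Matrix.smul_apply, smul_eq_mul, mul_apply, Fintype.sum_prod_type,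
      Fin.sum_univ_two]
    fin_cases i <;> fin_cases j <;> fin_cases k <;> fin_cases l <;>
      simp [magicBasis, cnotMatrix, kroneckerMap_apply] <;>
      first
      | linear_combination (-(1 / 2 : ℂ) * (q * p⁻¹)) * Complex.I_sq
      | linear_combination ((1 / 2 : ℂ) * (q * p⁻¹)) * Complex.I_sq
      | linear_combination (-(1 / 2 : ℂ) * (p * q⁻¹)) * Complex.I_sq

/-- The trace criterion for two C-NOTs. -/
lemma isTwoCnot_of_trace_im_eq_zero {U : TwoQubit}
    (hU : U ∈ Matrix.unitaryGroup (Fin 2 × Fin 2) ℂ) (hdet : U.det = 1)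
    (htr : (trace (Uᵀ * flipForm * U * flipForm)).im = 0) : IsTwoCnot U := by
  obtain ⟨L, L', ⟨A₁, hA₁, B₁, hB₁, -, -, rfl⟩, ⟨A₃, hA₃, B₃, hB₃, -, -, rfl⟩, x, y, hx, hy, h⟩ :=
    exists_local_mul_ofMagic_diagonal_mul_local hU hdet htr
  obtain ⟨P, hP, Q, hQ, hPQ⟩ := exists_ofMagic_diagonal_eq_cnot hx hy
  refine ⟨A₁, hA₁, B₁, hB₁, P, hP, Q, hQ, A₃, hA₃, B₃, hB₃, ?_⟩
  rw [h, hPQ]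
  simp only [mul_assoc]

lemma exists_cos_mul_add_sin_mul_eq_zero (p r : ℝ) :
    ∃ t : ℝ, Real.cos (2 * t) * p + Real.sin (2 * t) * r = 0 := by
  let z : ℂ := ⟨r, -p⟩
  refine ⟨z.arg / 2, ?_⟩
  rw [mul_div_cancel₀ _ (two_ne_zero)]
  by_cases hz : z = 0
  · have hr : r = 0 := congrArg Complex.re hz
    have hp : -p = 0 := congrArg Complex.im hz
    rw [hr, neg_eq_zero.mp hp]
    simp
  · rw [Complex.cos_arg hz, Complex.sin_arg]
    simp only [z]
    ring

/-- Along a family `F t` for which `(F t)ᵀ σ (F t)` turns in a plane with `2 t`, every unitary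
`U` admits a `t` such that `F t * U` satisfies the trace condition. -/
lemma exists_isTwoCnot_mul {F : ℝ → TwoQubit} {f : ℂ} {G₁ G₂ : TwoQubit}
    (hF : ∀ t, F t ∈ Matrix.unitaryGroup (Fin 2 × Fin 2) ℂ) (hf : ∀ t, (F t).det = f)
    (hG : ∀ t, (F t)ᵀ * flipForm * F t =
      ((Real.cos (2 * t) : ℝ) : ℂ) • G₁ + ((Real.sin (2 * t) : ℝ) : ℂ) • G₂)
    {U : TwoQubit} (hU : U ∈ Matrix.unitaryGroup (Fin 2 × Fin 2) ℂ) :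
    ∃ t, IsTwoCnot (F t * U) := by
  have hw : ‖f * U.det‖ = 1 := by
    have := det_of_mem_unitary (mul_mem (hF 0) hU)
    rw [det_mul, hf] at this
    exact CStarRing.norm_of_mem_unitary this
  -- a fourth root of the inverse determinant
  obtain ⟨κ, hκ, hκ4⟩ : ∃ κ : ℂ, ‖κ‖ = 1 ∧ κ ^ 4 * (f * U.det) = 1 := by
    obtain ⟨a, ha⟩ : ∃ a : ℝ, f * U.det = Complex.exp (a * Complex.I) := ⟨(f * U.det).arg, by
      conv_lhs => rw [← Complex.norm_mul_exp_arg_mul_I (f * U.det), hw, Complex.ofReal_one,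
        one_mul]⟩
    refine ⟨Complex.exp (((-a / 4 : ℝ) : ℂ) * Complex.I), Complex.norm_exp_ofReal_mul_I _, ?_⟩
    rw [ha, ← Complex.exp_nat_mul, ← Complex.exp_add, ← Complex.exp_zero]
    congr 1
    push_cast
    ring
  let τ : TwoQubit → ℂ := fun G => κ ^ 2 * trace (Uᵀ * G * U * flipForm)
  obtain ⟨t, ht⟩ := exists_cos_mul_add_sin_mul_eq_zero (τ G₁).im (τ G₂).im
  have hunit : κ • (F t * U) ∈ Matrix.unitaryGroup (Fin 2 × Fin 2) ℂ := by
    have hκ' : κ * star κ = 1 := by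
      rw [RCLike.star_def, Complex.mul_conj', hκ]; simp
    rw [mem_unitaryGroup_iff, star_smul, smul_mul_smul_comm,
      mem_unitaryGroup_iff.mp (mul_mem (hF t) hU), hκ', one_smul]
  have htwo : IsTwoCnot (κ • (F t * U)) := by
    refine isTwoCnot_of_trace_im_eq_zero hunit ?_ ?_
    · rw [det_smul, det_mul, hf]
      simpa using hκ4
    · have : trace ((κ • (F t * U))ᵀ * flipForm * (κ • (F t * U)) * flipForm) =
          ((Real.cos (2 * t) : ℝ) : ℂ) * τ G₁ + ((Real.sin (2 * t) : ℝ) : ℂ) * τ G₂ := by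
        have h : (κ • (F t * U))ᵀ * flipForm * (κ • (F t * U)) * flipForm =
            κ ^ 2 • (Uᵀ * ((F t)ᵀ * flipForm * F t) * U * flipForm) := by
          simp only [transpose_smul, transpose_mul, smul_mul_assoc, mul_smul_comm, smul_smul,
            mul_assoc, sq]
        rw [h, hG]
        simp only [mul_add, add_mul, mul_smul_comm, smul_mul_assoc, trace_smul, trace_add,
          smul_eq_mul, smul_add, τ]
        ring
      rw [this, Complex.add_im, Complex.im_ofReal_mul, Complex.im_ofReal_mul]
      exact ht
  have hκ0 : κ ≠ 0 := fun h => by simp [h] at hκ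
  have := htwo.smul (κ := κ⁻¹) (by rw [norm_inv, hκ, inv_one])
  rw [smul_smul, inv_mul_cancel₀ hκ0, one_smul] at this
  exact ⟨t, this⟩

lemma exp_mul_I_mul_self (t : ℝ) : Complex.exp (t * Complex.I) * Complex.exp (t * Complex.I) =
    ((Real.cos (2 * t) : ℝ) : ℂ) + ((Real.sin (2 * t) : ℝ) : ℂ) * Complex.I := by
  rw [← Complex.exp_add, Complex.ofReal_cos, Complex.ofReal_sin, ← Complex.exp_mul_I]
  congr 1
  push_cast
  ring

lemma exp_neg_mul_I_mul_self (t : ℝ) :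
    Complex.exp (-(t * Complex.I)) * Complex.exp (-(t * Complex.I)) =
      ((Real.cos (2 * t) : ℝ) : ℂ) - ((Real.sin (2 * t) : ℝ) : ℂ) * Complex.I := by
  have h := exp_mul_I_mul_self (-t)
  rw [mul_neg, Real.cos_neg, Real.sin_neg] at h
  push_cast at h ⊢
  rw [neg_mul, neg_mul] at h
  rw [h]
  ring

lemma norm_exp_neg_mul_I (t : ℝ) : ‖Complex.exp (-(t * Complex.I))‖ = 1 := by
  have := Complex.norm_exp_ofReal_mul_I (-t)
  push_cast at this
  rwa [neg_mul] at this

/-- A two-qubit unitary needs only two C-NOTs up to a diagonal `exp (i t Z ⊗ Z)`. -/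
lemma exists_diagonal_mul_isTwoCnot {U : TwoQubit}
    (hU : U ∈ Matrix.unitaryGroup (Fin 2 × Fin 2) ℂ) :
    ∃ δ : Fin 2 × Fin 2 → ℂ, (∀ c, ‖δ c‖ = 1) ∧ IsTwoCnot (diagonal δ * U) := by
  let δ : ℝ → Fin 2 × Fin 2 → ℂ := fun t c =>
    if c.1 = c.2 then Complex.exp (t * Complex.I) else Complex.exp (-(t * Complex.I))
  have hδ : ∀ t c, ‖δ t c‖ = 1 := fun t c => by
    simp only [δ]
    split_ifs
    · exact Complex.norm_exp_ofReal_mul_I t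
    · exact norm_exp_neg_mul_I t
  obtain ⟨t, ht⟩ := exists_isTwoCnot_mul (F := fun t => diagonal (δ t)) (f := 1)
    (G₁ := flipForm)
    (G₂ := Complex.I • (diagonal (fun c => if c.1 = c.2 then 1 else -1) * flipForm))
    (fun t => diagonal_mem_unitaryGroup (hδ t))
    (fun t => by
      have h : Complex.exp (t * Complex.I) * Complex.exp (-(t * Complex.I)) = 1 := by
        rw [← Complex.exp_add, add_neg_cancel, Complex.exp_zero]
      rw [det_diagonal, Fintype.prod_prod_type, Fin.prod_univ_two, Fin.prod_univ_two,
        Fin.prod_univ_two]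
      simp [δ, h, mul_comm (Complex.exp (-(t * Complex.I)))])
    (fun t => by
      have h1 := exp_mul_I_mul_self t
      have h2 := exp_neg_mul_I_mul_self t
      ext ⟨i, j⟩ ⟨k, l⟩
      rw [diagonal_transpose, mul_diagonal, diagonal_mul, Matrix.add_apply, Matrix.smul_apply,
        Matrix.smul_apply, Matrix.smul_apply, diagonal_mul]
      fin_cases i <;> fin_cases j <;> fin_cases k <;> fin_cases l <;>
        simp [δ, flipForm] <;> push_cast at h1 h2 <;>
        first
        | linear_combination h1
        | linear_combination h2
        | linear_combination -h1
        | linear_combination -h2)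
    hU
  exact ⟨δ t, hδ t, ht⟩

/-- A two-qubit unitary needs three C-NOTs: the first of them is used, together with a rotation of
its target, to reach the trace condition for two C-NOTs. -/
lemma exists_kronecker_mul_cnot_mul_isTwoCnot {U : TwoQubit}
    (hU : U ∈ Matrix.unitaryGroup (Fin 2 × Fin 2) ℂ) :
    ∃ R ∈ Matrix.unitaryGroup (Fin 2) ℂ, ∃ T, IsTwoCnot T ∧
      U = ((1 : Matrix (Fin 2) (Fin 2) ℂ) ⊗ₖ R) * cnotMatrix * T := by
  let R : ℝ → Matrix (Fin 2) (Fin 2) ℂ := fun t =>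
    diagonal ![Complex.exp (t * Complex.I), Complex.exp (-(t * Complex.I))]
  have hR : ∀ t, R t ∈ Matrix.unitaryGroup (Fin 2) ℂ := fun t =>
    diagonal_mem_unitaryGroup fun j => by
      fin_cases j
      · exact Complex.norm_exp_ofReal_mul_I t
      · exact norm_exp_neg_mul_I t
  have dR : ∀ t, (R t).det = 1 := fun t => by
    rw [det_diagonal, Fin.prod_univ_two]
    exact (Complex.exp_add _ _).symm.trans (by rw [add_neg_cancel, Complex.exp_zero])
  have hXZ : cnotMatrixᵀ * flipForm * cnotMatrix =
      of fun r c => if r.1 ≠ c.1 ∧ r.2 = c.2 then (if r.2 = 0 then 1 else -1) else 0 := by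
    ext ⟨i, j⟩ ⟨k, l⟩
    fin_cases i <;> fin_cases j <;> fin_cases k <;> fin_cases l <;>
      simp [cnotMatrix, flipForm, mul_apply, Fintype.sum_prod_type, Fin.sum_univ_two]
  have hRd : ∀ t, (1 : Matrix (Fin 2) (Fin 2) ℂ) ⊗ₖ R t = diagonal fun c : Fin 2 × Fin 2 =>
      ![Complex.exp (t * Complex.I), Complex.exp (-(t * Complex.I))] c.2 := fun t => by
    simp only [R]
    rw [← diagonal_one, diagonal_kronecker_diagonal]
    congr 1
    ext c
    rw [one_mul]
  have hu : ∀ t, cnotMatrix * ((1 : Matrix (Fin 2) (Fin 2) ℂ) ⊗ₖ R t) ∈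
      Matrix.unitaryGroup (Fin 2 × Fin 2) ℂ := fun t =>
    mul_mem cnotMatrix_mem_unitaryGroup (kronecker_mem_unitary (one_mem _) (hR t))
  obtain ⟨t, ht⟩ := exists_isTwoCnot_mul
    (F := fun t => cnotMatrix * ((1 : Matrix (Fin 2) (Fin 2) ℂ) ⊗ₖ R t)) (f := cnotMatrix.det)
    (G₁ := cnotMatrixᵀ * flipForm * cnotMatrix)
    (G₂ := Complex.I • of fun r c => if r.1 ≠ c.1 ∧ r.2 = c.2 then 1 else 0)
    hu
    (fun t => by simp [det_mul, det_kronecker, dR])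
    (fun t => by
      have h1 := exp_mul_I_mul_self t
      have h2 := exp_neg_mul_I_mul_self t
      rw [transpose_mul, hRd, diagonal_transpose,
        show ∀ D : TwoQubit, D * cnotMatrixᵀ * flipForm * (cnotMatrix * D) =
          D * (cnotMatrixᵀ * flipForm * cnotMatrix) * D from fun D => by simp only [mul_assoc],
        hXZ]
      ext ⟨i, j⟩ ⟨k, l⟩
      rw [mul_diagonal, diagonal_mul, Matrix.add_apply, Matrix.smul_apply,
        Matrix.smul_apply, Matrix.smul_apply]
      fin_cases i <;> fin_cases j <;> fin_cases k <;> fin_cases l <;>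
        simp <;> push_cast at h1 h2 <;>
        first
        | linear_combination h1
        | linear_combination -h2)
    hU
  refine ⟨(R t)ᴴ, Unitary.star_mem (hR t), _, ht, ?_⟩
  rw [show ((1 : Matrix (Fin 2) (Fin 2) ℂ) ⊗ₖ (R t)ᴴ) * cnotMatrix *
      (cnotMatrix * ((1 : Matrix (Fin 2) (Fin 2) ℂ) ⊗ₖ R t) * U) =
    ((1 : Matrix (Fin 2) (Fin 2) ℂ) ⊗ₖ (R t)ᴴ) * (cnotMatrix * cnotMatrix) *
      ((1 : Matrix (Fin 2) (Fin 2) ℂ) ⊗ₖ R t) * U by simp only [mul_assoc],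
    cnotMatrix_mul_self, mul_one, ← mul_kronecker_mul, unitary_conjTranspose_mul (hR t), mul_one,
    one_kronecker_one, one_mul]

lemma single_zero_toMatrix (u : Matrix.unitaryGroup (Fin 2) ℂ) :
    (Gate.single (0 : Fin 2) u).toMatrix =
      ((u : Matrix (Fin 2) (Fin 2) ℂ) ⊗ₖ (1 : Matrix (Fin 2) (Fin 2) ℂ)).submatrix
        (finTwoArrowEquiv (Fin 2)) (finTwoArrowEquiv (Fin 2)) := by
  ext x y
  simp [Gate.toMatrix, Fin.forall_fin_two, one_apply]

lemma single_one_toMatrix (u : Matrix.unitaryGroup (Fin 2) ℂ) :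
    (Gate.single (1 : Fin 2) u).toMatrix =
      ((1 : Matrix (Fin 2) (Fin 2) ℂ) ⊗ₖ (u : Matrix (Fin 2) (Fin 2) ℂ)).submatrix
        (finTwoArrowEquiv (Fin 2)) (finTwoArrowEquiv (Fin 2)) := by
  ext x y
  simp [Gate.toMatrix, Fin.forall_fin_two, one_apply]

lemma cnot_zero_one_toMatrix :
    (Gate.cnot (0 : Fin 2) 1 zero_ne_one).toMatrix =
      cnotMatrix.submatrix (finTwoArrowEquiv (Fin 2)) (finTwoArrowEquiv (Fin 2)) := by
  ext x y
  simp [Gate.toMatrix, cnotMatrix, funext_iff, Fin.forall_fin_two]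

lemma synthesizable_kronecker {A B : Matrix (Fin 2) (Fin 2) ℂ}
    (hA : A ∈ Matrix.unitaryGroup (Fin 2) ℂ) (hB : B ∈ Matrix.unitaryGroup (Fin 2) ℂ) :
    Synthesizable 0 ((A ⊗ₖ B).submatrix (finTwoArrowEquiv (Fin 2)) (finTwoArrowEquiv (Fin 2))) := by
  have := (synthesizable_single (0 : Fin 2) hA).mul (synthesizable_single (1 : Fin 2) hB)
  rwa [single_zero_toMatrix, single_one_toMatrix, submatrix_mul_equiv, ← mul_kronecker_mul,
    mul_one, one_mul] at this

lemma synthesizable_cnotMatrix : Synthesizable 1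
    (cnotMatrix.submatrix (finTwoArrowEquiv (Fin 2)) (finTwoArrowEquiv (Fin 2))) := by
  rw [← cnot_zero_one_toMatrix]
  exact synthesizable_cnot _

lemma IsTwoCnot.synthesizable {U : TwoQubit} (h : IsTwoCnot U) :
    Synthesizable 2 (U.submatrix (finTwoArrowEquiv (Fin 2)) (finTwoArrowEquiv (Fin 2))) := by
  obtain ⟨A₁, hA₁, B₁, hB₁, A₂, hA₂, B₂, hB₂, A₃, hA₃, B₃, hB₃, rfl⟩ := h
  simp only [← submatrix_mul_equiv _ _ _ (finTwoArrowEquiv (Fin 2))]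
  exact ((((synthesizable_kronecker hA₁ hB₁).mul synthesizable_cnotMatrix).mul
    (synthesizable_kronecker hA₂ hB₂)).mul synthesizable_cnotMatrix).mul
    (synthesizable_kronecker hA₃ hB₃)

lemma twoQubit_synthesis {U : Matrix (Bits (Fin 2)) (Bits (Fin 2)) ℂ}
    (hU : U ∈ Matrix.unitaryGroup (Bits (Fin 2)) ℂ) :
    SynthesizableUpToDiagonal 2 U ∧ Synthesizable 3 U := by
  have hU' := submatrix_equiv_mem_unitaryGroup (finTwoArrowEquiv (Fin 2)).symm hU
  have hUU : U = (U.submatrix (finTwoArrowEquiv (Fin 2)).symm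
      (finTwoArrowEquiv (Fin 2)).symm).submatrix (finTwoArrowEquiv (Fin 2))
      (finTwoArrowEquiv (Fin 2)) := by
    rw [submatrix_submatrix, Equiv.symm_comp_self, submatrix_id_id]
  constructor
  · obtain ⟨δ, hδ, h⟩ := exists_diagonal_mul_isTwoCnot hU'
    refine ⟨δ ∘ finTwoArrowEquiv (Fin 2), fun j => hδ _, ?_⟩
    rw [← submatrix_diagonal_equiv, hUU, submatrix_mul_equiv]
    exact h.synthesizable
  · obtain ⟨R, hR, T, hT, h⟩ := exists_kronecker_mul_cnot_mul_isTwoCnot hU'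
    rw [hUU, h, ← submatrix_mul_equiv _ _ _ (finTwoArrowEquiv (Fin 2)),
      ← submatrix_mul_equiv _ _ _ (finTwoArrowEquiv (Fin 2))]
    exact ((synthesizable_kronecker (one_mem _) hR).mul synthesizable_cnotMatrix).mul
      hT.synthesizable

/-! ### Synthesis of arbitrary unitaries -/

/-- The number of C-NOTs for a unitary on `m` qubits up to a diagonal. In the recursion the first
summand stands for the leftmost of the four system unitaries. -/
def diagonalCost : ℕ → ℕ
  | 0 => 0
  | 1 => 0
  | 2 => 2
  | m + 3 => diagonalCost (m + 2) + (3 * diagonalCost (m + 2) + 3 * 2 ^ (m + 2) - 2)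

lemma diagonalCost_eq (m : ℕ) :
    (diagonalCost (m + 2) : ℝ) = 11 / 24 * 4 ^ (m + 2) - 3 / 2 * 2 ^ (m + 2) + 2 / 3 := by
  induction m with
  | zero => norm_num [diagonalCost]
  | succ m ih =>
    have h : diagonalCost (m + 3) + 2 = 4 * diagonalCost (m + 2) + 3 * 2 ^ (m + 2) := by
      have := Nat.one_le_two_pow (n := m + 2)
      rw [diagonalCost]
      omega
    have h' : (diagonalCost (m + 3) : ℝ) + 2 = 4 * diagonalCost (m + 2) + 3 * 2 ^ (m + 2) := by
      exact_mod_cast h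
    rw [show m + 1 + 2 = m + 3 from rfl, pow_succ 4 (m + 2), pow_succ 2 (m + 2)]
    linear_combination h' + 4 * ih

lemma synthesis_add_two (m : ℕ) : ∀ U ∈ Matrix.unitaryGroup (Bits (Fin (m + 2))) ℂ,
    SynthesizableUpToDiagonal (diagonalCost (m + 2)) U ∧
      Synthesizable (diagonalCost (m + 2) + 1) U := by
  induction m with
  | zero => exact fun U hU => twoQubit_synthesis hU
  | succ m ih =>
    intro U hU
    have h := synthesis_succ (fun V hV => (ih V hV).1) (fun V hV => (ih V hV).2) hU
    exact ⟨h.1, h.2.mono (Nat.add_right_comm _ _ _).le⟩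

lemma synthesizable_of_one_qubit {U : Matrix (Bits (Fin 1)) (Bits (Fin 1)) ℂ}
    (hU : U ∈ Matrix.unitaryGroup (Bits (Fin 1)) ℂ) : Synthesizable 0 U := by
  let e := Equiv.funUnique (Fin 1) (Fin 2)
  have h := synthesizable_single (0 : Fin 1) (submatrix_equiv_mem_unitaryGroup e.symm hU)
  have hg : (Gate.single (0 : Fin 1) ⟨_, submatrix_equiv_mem_unitaryGroup e.symm hU⟩).toMatrix =
      U := by
    ext x y
    rw [Gate.toMatrix, of_apply, if_pos fun r hr => absurd (Subsingleton.elim r 0) hr]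
    change U (e.symm (x 0)) (e.symm (y 0)) = U x y
    exact congrArg₂ U (e.symm_apply_apply x) (e.symm_apply_apply y)
  rwa [hg] at h

/-- The two system circuits of the block encoding: `V` up to a diagonal, then the exact `W`
corrected by that diagonal. Without system qubits a phase is a gate on the ancilla. -/
lemma exists_system_circuits {m : ℕ} {V W : Matrix (Bits (Fin m)) (Bits (Fin m)) ℂ}
    (hV : V ∈ Matrix.unitaryGroup (Bits (Fin m)) ℂ)
    (hW : W ∈ Matrix.unitaryGroup (Bits (Fin m)) ℂ) :
    ∃ (δ : Bits (Fin m) → ℂ) (CV CW : Circuit (Fin 1 ⊕ Fin m)), (∀ j, ‖δ j‖ = 1) ∧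
      (∀ g ∈ CV ++ CW, g.InteractsWithin (Set.range Sum.inr)) ∧
      CV.toMatrix = tensor 1 (diagonal δ * V) ∧
      CW.toMatrix = tensor 1 (W * (diagonal δ)ᴴ) ∧
      CV.cnotCount ≤ diagonalCost m ∧
      CW.cnotCount ≤ diagonalCost m + if m < 2 then 0 else 1 := by
  have embed : ∀ {k l : ℕ}, SynthesizableUpToDiagonal k V →
      (∀ U ∈ Matrix.unitaryGroup (Bits (Fin m)) ℂ, Synthesizable l U) →
      ∃ (δ : Bits (Fin m) → ℂ) (CV CW : Circuit (Fin 1 ⊕ Fin m)), (∀ j, ‖δ j‖ = 1) ∧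
      (∀ g ∈ CV ++ CW, g.InteractsWithin (Set.range Sum.inr)) ∧
      CV.toMatrix = tensor 1 (diagonal δ * V) ∧ CW.toMatrix = tensor 1 (W * (diagonal δ)ᴴ) ∧
      CV.cnotCount ≤ k ∧ CW.cnotCount ≤ l := by
    rintro k l ⟨δ, hδ, C, hC, hk⟩ hl
    obtain ⟨D, hD, hl⟩ := hl (W * (diagonal δ)ᴴ)
      (mul_mem hW (Unitary.star_mem (diagonal_mem_unitaryGroup hδ)))
    refine ⟨δ, Circuit.map .inr C, Circuit.map .inr D, hδ, ?_, ?_, ?_, ?_, ?_⟩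
    · intro g hg
      rw [Circuit.map, Circuit.map, ← List.map_append, List.mem_map] at hg
      obtain ⟨g, -, rfl⟩ := hg
      exact g.map_interactsWithin _
    · rw [Circuit.toMatrix_map_inr, hC]
    · rw [Circuit.toMatrix_map_inr, hD]
    · rwa [Circuit.cnotCount_map]
    · rwa [Circuit.cnotCount_map]
  match m with
  | 0 =>
    let i : Bits (Fin 0) := default
    have hdiag : ∀ U : Matrix (Bits (Fin 0)) (Bits (Fin 0)) ℂ, U = diagonal fun _ => U i i := by
      intro U
      ext x y
      rw [Subsingleton.elim x i, Subsingleton.elim y i, diagonal_apply_eq]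
    have hW1 : ‖W i i‖ = 1 :=
      norm_eq_one_of_diagonal_mem_unitaryGroup (d := fun _ => W i i) (hdiag W ▸ hW) i
    have hV1 : ‖V i i‖ = 1 :=
      norm_eq_one_of_diagonal_mem_unitaryGroup (d := fun _ => V i i) (hdiag V ▸ hV) i
    have hu : ∀ {z : ℂ}, ‖z‖ = 1 → (diagonal fun _ => z) ∈ Matrix.unitaryGroup (Fin 2) ℂ :=
      fun h => diagonal_mem_unitaryGroup fun _ => h
    have ht : ∀ z : ℂ, tensor (diagonal fun _ => z) (1 : Matrix (Bits (Fin 0)) (Bits (Fin 0)) ℂ) =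
        tensor 1 (diagonal fun _ => z) := by
      intro z
      rw [tensor_eq_blocks, tensor_eq_blocks]
      simp [smul_one_eq_diagonal]
    refine ⟨fun _ => 1, [.single (Sum.inl 0) ⟨_, hu hV1⟩], [.single (Sum.inl 0) ⟨_, hu hW1⟩],
      fun _ => norm_one, ?_, ?_, ?_, ?_, ?_⟩
    · intro g hg
      simp only [List.cons_append, List.nil_append, List.mem_cons, List.not_mem_nil, or_false] at hg
      rcases hg with rfl | rfl <;> trivial
    · rw [Circuit.toMatrix, Circuit.toMatrix, one_mul, ancillaSingle_toMatrix, ht, ← hdiag,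
        diagonal_one, one_mul]
    · rw [Circuit.toMatrix, Circuit.toMatrix, one_mul, ancillaSingle_toMatrix, ht, ← hdiag,
        diagonal_one, conjTranspose_one, mul_one]
    · simp [Circuit.cnotCount, Gate.isCnot]
    · simp [Circuit.cnotCount, Gate.isCnot]
  | 1 =>
    refine embed ⟨fun _ => 1, fun _ => norm_one, ?_⟩ fun U hU => synthesizable_of_one_qubit hU
    rw [diagonal_one, one_mul]
    exact synthesizable_of_one_qubit hV
  | m + 2 =>
    rw [if_neg (by omega)]
    exact embed (synthesis_add_two m V hV).1 fun U hU => (synthesis_add_two m U hU).2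

/-! ### Spectral norms and block encodings -/

section SpectralNorm

open scoped Matrix.Norms.L2Operator

lemma specNorm_eq_norm {ι : Type} [Fintype ι] [DecidableEq ι] (A : Matrix ι ι ℂ) :
    specNorm A = ‖A‖ := l2_opNorm_toEuclideanCLM A

/-- A submatrix of a unitary is a contraction: it is `Jᴴ U J` for an isometry `J`. -/
lemma specNorm_submatrix_le_one {ι κ : Type} [Fintype ι] [DecidableEq ι] [Fintype κ]
    [DecidableEq κ] {U : Matrix κ κ ℂ} (hU : U ∈ Matrix.unitaryGroup κ ℂ) {f : ι → κ}
    (hf : Function.Injective f) : specNorm (U.submatrix f f) ≤ 1 := by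
  rw [specNorm_eq_norm]
  let J : Matrix κ ι ℂ := (1 : Matrix κ κ ℂ).submatrix id f
  have hJJ : Jᴴ * J = 1 := by
    ext i j
    simp [J, mul_apply, one_apply, hf.eq_iff]
  have hle : ∀ {a b : Type} [Fintype a] [DecidableEq a] [Fintype b] [DecidableEq b]
      (M : Matrix a b ℂ), Mᴴ * M = 1 → ‖M‖ ≤ 1 := by
    intro a b _ _ _ _ M hM
    have h1 := l2_opNorm_conjTranspose_mul_self M
    have h2 : ‖(1 : Matrix b b ℂ)‖ ≤ 1 := by
      rw [← diagonal_one, l2_opNorm_diagonal]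
      exact (pi_norm_le_iff_of_nonneg zero_le_one).mpr fun _ => norm_one.le
    rw [hM] at h1
    nlinarith [norm_nonneg M]
  have hsub : U.submatrix f f = Jᴴ * U * J := by
    ext i j
    simp [J, mul_apply, one_apply]
  have hJ := hle J hJJ
  have hU' := hle U (unitary_conjTranspose_mul hU)
  calc ‖U.submatrix f f‖ ≤ ‖Jᴴ‖ * ‖U‖ * ‖J‖ := by
        rw [hsub]
        exact (l2_opNorm_mul _ _).trans
          (mul_le_mul_of_nonneg_right (l2_opNorm_mul _ _) (norm_nonneg _))
    _ ≤ 1 * 1 * 1 := by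
        rw [l2_opNorm_conjTranspose]
        gcongr
    _ = 1 := by norm_num

lemma specNorm_le_of_isBlockEncoding {m a : ℕ} {α : ℝ} {A : Matrix (Bits (Fin m)) (Bits (Fin m)) ℂ}
    {U : Matrix (Bits (Fin a ⊕ Fin m)) (Bits (Fin a ⊕ Fin m)) ℂ}
    (h : IsBlockEncoding α a 0 A U) : specNorm A ≤ α := by
  obtain ⟨hα, hU, hA⟩ := h
  have hinj : Function.Injective
      (fun i : Bits (Fin m) => (Sum.elim (fun _ => 0) i : Bits (Fin a ⊕ Fin m))) :=
    fun i j hij => funext fun r => congrFun hij (Sum.inr r)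
  have h1 := specNorm_submatrix_le_one hU hinj
  rw [specNorm_eq_norm] at hA h1 ⊢
  rw [sub_eq_zero.mp (norm_le_zero_iff.mp hA), norm_smul, Complex.norm_real, Real.norm_eq_abs,
    abs_of_pos hα]
  exact mul_le_of_le_one_right hα.le h1

/-- Singular value decomposition of a nonsingular matrix, the singular values being written as
`‖A‖ cos θ`. -/
lemma exists_svd_cos {ι : Type} [Fintype ι] [DecidableEq ι] [Nonempty ι] {A : Matrix ι ι ℂ}
    (hA : A.rank = Fintype.card ι) :
    0 < specNorm A ∧ ∃ W ∈ Matrix.unitaryGroup ι ℂ, ∃ V ∈ Matrix.unitaryGroup ι ℂ, ∃ θ : ι → ℝ,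
      (∀ j, 0 < Real.cos (θ j)) ∧ A = (specNorm A : ℂ) •
        (W * diagonal (fun j => ((Real.cos (θ j) : ℝ) : ℂ)) * Vᴴ) := by
  obtain ⟨P, hP, R, hR, s, hs, h⟩ := exists_singular_value_decomposition A
  have hpos : 0 < specNorm A := by
    rw [specNorm_eq_norm, norm_pos_iff]
    rintro rfl
    rw [rank_zero] at hA
    exact Fintype.card_ne_zero hA.symm
  have hdet : IsUnit A.det := by
    rw [← isUnit_iff_isUnit_det, ← mulVec_surjective_iff_isUnit]
    have htop : LinearMap.range A.mulVecLin = ⊤ :=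
      Submodule.eq_top_of_finrank_eq (by rw [Module.finrank_fintype_fun_eq_card]; exact hA)
    exact LinearMap.range_eq_top.mp htop
  have hs0 : ∀ j, 0 < s j := by
    intro j
    refine lt_of_le_of_ne (hs j) fun h0 => ?_
    rw [h, det_mul, det_mul, det_diagonal,
      Finset.prod_eq_zero (Finset.mem_univ j) (by rw [← h0, Complex.ofReal_zero])] at hdet
    simp at hdet
  have hle : ∀ j, s j ≤ specNorm A := by
    intro j
    have hd : diagonal (fun i => (s i : ℂ)) = Pᴴ * A * Rᴴ := by
      rw [h, show Pᴴ * (P * diagonal (fun i => (s i : ℂ)) * R) * Rᴴ =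
        (Pᴴ * P) * diagonal (fun i => (s i : ℂ)) * (R * Rᴴ) by simp only [mul_assoc],
        unitary_conjTranspose_mul hP, unitary_mul_conjTranspose hR, one_mul, mul_one]
    have h1 : ∀ {M : Matrix ι ι ℂ}, M ∈ Matrix.unitaryGroup ι ℂ → ‖Mᴴ‖ ≤ 1 := fun {M} hM => by
      have := specNorm_submatrix_le_one (Unitary.star_mem hM) (Function.injective_id (α := ι))
      rwa [submatrix_id_id, specNorm_eq_norm] at this
    calc s j = ‖(s j : ℂ)‖ := by rw [Complex.norm_real, Real.norm_eq_abs, abs_of_pos (hs0 j)]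
      _ ≤ ‖diagonal (fun i => (s i : ℂ))‖ := by
        rw [l2_opNorm_diagonal]
        exact norm_le_pi_norm (fun i => (s i : ℂ)) j
      _ ≤ ‖Pᴴ‖ * ‖A‖ * ‖Rᴴ‖ := by
        rw [hd]
        exact (l2_opNorm_mul _ _).trans
          (mul_le_mul_of_nonneg_right (l2_opNorm_mul _ _) (norm_nonneg _))
      _ ≤ 1 * ‖A‖ * 1 := by
        gcongr
        · exact h1 hP
        · exact h1 hR
      _ = specNorm A := by rw [one_mul, mul_one, specNorm_eq_norm]
  have hcos : ∀ j, Real.cos (Real.arccos (s j / specNorm A)) = s j / specNorm A := fun j =>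
    Real.cos_arccos (by have := div_nonneg (hs j) hpos.le; linarith)
      ((div_le_one hpos).mpr (hle j))
  refine ⟨hpos, P, hP, Rᴴ, Unitary.star_mem hR, fun j => Real.arccos (s j / specNorm A),
    fun j => by rw [hcos]; exact div_pos (hs0 j) hpos, ?_⟩
  have hne : (specNorm A : ℂ) ≠ 0 := by exact_mod_cast hpos.ne'
  have hD : diagonal (fun i => (s i : ℂ)) = (specNorm A : ℂ) • diagonal
      (fun j => ((Real.cos (Real.arccos (s j / specNorm A)) : ℝ) : ℂ)) := by
    rw [← diagonal_smul]
    congr 1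
    ext j
    rw [Pi.smul_apply, hcos, smul_eq_mul, Complex.ofReal_div, mul_div_cancel₀ _ hne]
  conv_lhs => rw [h, hD]
  rw [conjTranspose_conjTranspose, mul_smul_comm, smul_mul_assoc]

end SpectralNorm

/-! ### The block encoding -/

variable {m : ℕ}

lemma unitaryGroup_mul_diagonal_exp_mul {ι : Type} [Fintype ι] [DecidableEq ι]
    {W V : Matrix ι ι ℂ} (hW : W ∈ Matrix.unitaryGroup ι ℂ) (hV : V ∈ Matrix.unitaryGroup ι ℂ)
    (θ : ι → ℝ) :
    W * diagonal (fun j => Complex.exp (Complex.I * θ j)) * Vᴴ ∈ Matrix.unitaryGroup ι ℂ ∧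
      W * diagonal (fun j => Complex.exp (-(Complex.I * θ j))) * Vᴴ ∈
        Matrix.unitaryGroup ι ℂ := by
  refine ⟨mul_mem (mul_mem hW (diagonal_mem_unitaryGroup fun j => ?_)) (Unitary.star_mem hV),
    mul_mem (mul_mem hW (diagonal_mem_unitaryGroup fun j => ?_)) (Unitary.star_mem hV)⟩
  · rw [mul_comm, Complex.norm_exp_ofReal_mul_I]
  · rw [show -(Complex.I * (θ j : ℂ)) = ((-θ j : ℝ) : ℂ) * Complex.I by push_cast; ring,
      Complex.norm_exp_ofReal_mul_I]

lemma half_smul_diagonal_exp_add {ι : Type} [Fintype ι] [DecidableEq ι] (W V : Matrix ι ι ℂ)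
    (θ : ι → ℝ) :
    (1 / 2 : ℂ) • (W * diagonal (fun j => Complex.exp (Complex.I * θ j)) * Vᴴ +
      W * diagonal (fun j => Complex.exp (-(Complex.I * θ j))) * Vᴴ) =
      W * diagonal (fun j => ((Real.cos (θ j) : ℝ) : ℂ)) * Vᴴ := by
  rw [← add_mul, ← mul_add, diagonal_add, ← smul_mul_assoc, ← mul_smul_comm, ← diagonal_smul]
  congr 3
  ext j
  rw [Pi.smul_apply, smul_eq_mul, Complex.ofReal_cos, Complex.cos,
    mul_comm Complex.I, neg_mul]
  ring

/-- The diagonal `δ` by which the two system circuits are off commutes with the uniformly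
controlled rotation and cancels. -/
lemma tensor_mul_ucrz_mul_tensor {W V : Matrix (Bits (Fin m)) (Bits (Fin m)) ℂ}
    {δ : Bits (Fin m) → ℂ} (hδ : ∀ j, ‖δ j‖ = 1) (θ : Bits (Fin m) → ℝ) :
    tensor 1 (W * (diagonal δ)ᴴ) * ucrz (fun j => 2 * θ j) * tensor 1 (diagonal δ * V) =
      multiplexor (W * diagonal (fun j => Complex.exp (Complex.I * θ j)) * V)
        (W * diagonal (fun j => Complex.exp (-(Complex.I * θ j))) * V) := by
  have h : ∀ d : Bits (Fin m) → ℂ, W * (diagonal δ)ᴴ * diagonal d * (diagonal δ * V) =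
      W * diagonal d * V := by
    intro d
    have : (diagonal δ)ᴴ * diagonal δ = 1 :=
      unitary_conjTranspose_mul (diagonal_mem_unitaryGroup hδ)
    calc W * (diagonal δ)ᴴ * diagonal d * (diagonal δ * V)
        = W * ((diagonal δ)ᴴ * (diagonal d * diagonal δ)) * V := by simp only [mul_assoc]
      _ = W * ((diagonal δ)ᴴ * diagonal δ * diagonal d) * V := by
          rw [(commute_diagonal d δ).eq, mul_assoc (diagonal δ)ᴴ]
      _ = _ := by rw [this, one_mul]
  simp only [tensor_one_eq_blocks, ucrz_eq_blocks, multiplexor_eq_blocks, blocks_mul, mul_zero,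
    zero_mul, add_zero, zero_add, h]
  simp

lemma isBlockEncoding_hadamard_conj {α : ℝ} (hα : 0 < α)
    {A A₁ A₂ : Matrix (Bits (Fin m)) (Bits (Fin m)) ℂ}
    (h₁ : A₁ ∈ Matrix.unitaryGroup (Bits (Fin m)) ℂ)
    (h₂ : A₂ ∈ Matrix.unitaryGroup (Bits (Fin m)) ℂ)
    (hA : A = (α : ℂ) • ((1 / 2 : ℂ) • (A₁ + A₂))) :
    IsBlockEncoding α 1 0 A (tensor hMatrix 1 * multiplexor A₁ A₂ * tensor hMatrix 1) := by
  refine ⟨hα, mul_mem (mul_mem ancillaHadamard_mem_unitaryGroup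
    (multiplexor_mem_unitaryGroup h₁ h₂)) ancillaHadamard_mem_unitaryGroup, ?_⟩
  have h := hadamard_conj_multiplexor A₁ A₂
  rw [ancillaHadamard, eq_blocks_iff] at h
  have hsub : (tensor hMatrix 1 * multiplexor A₁ A₂ * tensor hMatrix 1).submatrix
      (fun i : Bits (Fin m) => (Sum.elim (fun _ => 0) i : Bits (Fin 1 ⊕ Fin m)))
      (fun j => Sum.elim (fun _ => 0) j) = (1 / 2 : ℂ) • (A₁ + A₂) :=
    Matrix.ext fun i j => (h i j).1
  rw [hsub, ← hA, sub_self, specNorm, map_zero, norm_zero]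

/-- An equality for `m = 1` and for `2 ≤ m`. -/
lemma cnot_count_bound (m : ℕ) :
    ((diagonalCost m + 2 ^ m + (diagonalCost m + if m < 2 then 0 else 1) : ℕ) : ℝ) ≤
      11 / 48 * 4 ^ (m + 1) - 2 ^ (m + 1) + 7 / 3 := by
  match m with
  | 0 => norm_num [diagonalCost]
  | 1 => norm_num [diagonalCost]
  | m + 2 =>
    rw [if_neg (by omega)]
    push_cast
    rw [diagonalCost_eq, pow_succ _ (m + 2), pow_succ _ (m + 2)]
    linarith

end SIABLE

open SIABLE in
/-- With `n = m + 1`: the single-ancilla block encoding of a full-rank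
`2 ^ (n - 1) × 2 ^ (n - 1)` matrix. -/
theorem theorem2 (m : ℕ) (A : Matrix (Bits (Fin m)) (Bits (Fin m)) ℂ)
    (hA : A.rank = 2 ^ m) :
    -- `‖A‖₂` is a lower bound for the normalization factor of every exact block encoding
    (∀ (a : ℕ) (α : ℝ) (U : Matrix (Bits (Fin a ⊕ Fin m)) (Bits (Fin a ⊕ Fin m)) ℂ),
      IsBlockEncoding α a 0 A U → specNorm A ≤ α) ∧
    -- and it is attained with one ancilla by the following circuit
    ∃ (W V A₁ A₂ : Matrix (Bits (Fin m)) (Bits (Fin m)) ℂ)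
      (θ : Bits (Fin m) → ℝ) (δ : Bits (Fin m) → ℂ)
      (CV CZ CW C : Circuit (Fin 1 ⊕ Fin m)),
      -- a singular value decomposition of `A / ‖A‖₂`
      W ∈ Matrix.unitaryGroup (Bits (Fin m)) ℂ ∧
      V ∈ Matrix.unitaryGroup (Bits (Fin m)) ℂ ∧
      (∀ j, 0 < Real.cos (θ j)) ∧
      A = (specNorm A : ℂ) •
        (W * Matrix.diagonal (fun j => ((Real.cos (θ j) : ℝ) : ℂ)) * Vᴴ) ∧
      -- the two unitaries whose mean is `A / ‖A‖₂`
      A₁ ∈ Matrix.unitaryGroup (Bits (Fin m)) ℂ ∧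
      A₂ ∈ Matrix.unitaryGroup (Bits (Fin m)) ℂ ∧
      A₁ = W * Matrix.diagonal (fun j => Complex.exp (Complex.I * θ j)) * Vᴴ ∧
      A₂ = W * Matrix.diagonal (fun j => Complex.exp (-(Complex.I * θ j))) * Vᴴ ∧
      A = (specNorm A : ℂ) • ((1 / 2 : ℂ) • (A₁ + A₂)) ∧
      -- the three parts of the circuit: `Vᴴ` up to a diagonal unitary `Δ`, the uniformly
      -- controlled rotation, and `W` corrected by `Δᴴ`; the
      -- C-NOTs of the first and of the last part act on the `m` system qubits only
      (∀ j, ‖δ j‖ = 1) ∧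
      (∀ g ∈ CV ++ CW, g.InteractsWithin (Set.range Sum.inr)) ∧
      CV.toMatrix = tensor 1 (Matrix.diagonal δ * Vᴴ) ∧
      CZ.toMatrix = ucrz (fun j => 2 * θ j) ∧
      CW.toMatrix = tensor 1 (W * (Matrix.diagonal δ)ᴴ) ∧
      -- the whole circuit
      C = [hadamardGate m] ++ CV ++ CZ ++ CW ++ [hadamardGate m] ∧
      C.toMatrix = tensor hMatrix 1 * multiplexor A₁ A₂ * tensor hMatrix 1 ∧
      IsBlockEncoding (specNorm A) 1 0 A C.toMatrix ∧
      (C.cnotCount : ℝ) ≤ 11 / 48 * 4 ^ (m + 1) - 2 ^ (m + 1) + 7 / 3 := by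
  refine ⟨fun a α U => specNorm_le_of_isBlockEncoding, ?_⟩
  obtain ⟨hpos, W, hW, V, hV, θ, hθ, hAsvd⟩ :=
    exists_svd_cos (A := A) (by rw [hA]; simp [Bits])
  obtain ⟨h₁, h₂⟩ := unitaryGroup_mul_diagonal_exp_mul hW hV θ
  obtain ⟨δ, CV, CW, hδ, hwithin, hCV, hCW, hkV, hkW⟩ :=
    exists_system_circuits (Unitary.star_mem hV) hW
  obtain ⟨CZ, hCZ, hkZ⟩ := synthesizable_ucrz fun j => 2 * θ j
  have hmean := hAsvd
  rw [← half_smul_diagonal_exp_add] at hmean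
  have hH : (hadamardGate m).toMatrix = tensor hMatrix 1 := ancillaSingle_toMatrix _
  have hC : Circuit.toMatrix ([hadamardGate m] ++ CV ++ CZ ++ CW ++ [hadamardGate m]) =
      tensor hMatrix 1 * multiplexor
        (W * diagonal (fun j => Complex.exp (Complex.I * θ j)) * Vᴴ)
        (W * diagonal (fun j => Complex.exp (-(Complex.I * θ j))) * Vᴴ) * tensor hMatrix 1 := by
    rw [← tensor_mul_ucrz_mul_tensor hδ]
    simp only [Circuit.toMatrix_append, Circuit.toMatrix, one_mul, hH, hCV, hCZ, hCW, mul_assoc]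
    rfl
  refine ⟨W, V, _, _, θ, δ, CV, CZ, CW, _, hW, hV, hθ, hAsvd, h₁, h₂, rfl, rfl, hmean, hδ, hwithin,
    hCV, hCZ, hCW, rfl, hC, ?_, ?_⟩
  · rw [hC]
    exact isBlockEncoding_hadamard_conj hpos h₁ h₂ hmean
  · refine le_trans ?_ (cnot_count_bound m)
    have hcount : Circuit.cnotCount ([hadamardGate m] ++ CV ++ CZ ++ CW ++ [hadamardGate m]) =
        CV.cnotCount + CZ.cnotCount + CW.cnotCount := by
      have h0 : Circuit.cnotCount [hadamardGate m] = 0 := rfl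
      simp only [Circuit.cnotCount_append, h0, zero_add, add_zero]
    rw [hcount]
    exact_mod_cast add_le_add (add_le_add hkV hkZ) hkW
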